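/- Let $K$ be a compact group acting continuously on $\mathbb R^n$ by linear isometries (for instance a compact subgroup $K\subset \mathrm O(n)$), and let $\rho_1,\dots,\rho_\ell$ be generators of the algebra $\mathcal P(\mathbb R^n)^K$ of $K$-invariant real polynomials on $\mathbb R^n$. Write $\rho=(\rho_1,\dots,\rho_\ell):\mathbb R^n\to\mathbb R^\ell$ and $$\widehat f(\xi)=\int_{\mathbb R^n} f(x)\,e^{-i\langle x,\xi\rangle}\,dx,\qquad \varphi_\xi(x)=\int_K e^{i\langle x,k\cdot\xi\rangle}\,dk ,$$ where $dk$ is the normalized Haar measure of $K$. Then there are functions $h_\xi:\mathbb R^\ell\to\mathbb C$ ($\xi\in\mathbb R^n$), depending only on $K$, its action and $\rho$, such that: 1. each $h_\xi$ is real analytic on $\mathbb R^\ell$, and $\varphi_\xi(x)=h_\xi(\rho(x))$ for all $x,\xi\in\mathbb R^n$; 2. if all the $\rho_j$ are homogeneous, there are polynomials $q_J\in\mathbb C[t_1,\dots,t_\ell]$ ($J\in\mathbb N^\ell$) such that, for all $\xi\in\mathbb R^n$ and $t\in\mathbb R^\ell$, $$h_\xi(t)=\sum_{J} q_J(\rho(\xi))\,t^J$$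 with absolute convergence, and such that for every $m\ge 0$ the homogeneous part of degree $m$ of the Taylor expansion of $\varphi_\xi$ at $0$ equals $\sum_{j_1\deg\rho_1+\dots+j_\ell\deg\rho_\ell=m}q_J(\rho(\xi))\,\rho_1(x)^{j_1}\cdots\rho_\ell(x)^{j_\ell}$ for all $x,\xi$ (with the convention $\deg 0=0$); 3. for every $K$-invariant $f\in L^1(\mathbb R^n)$ whose Fourier transform $\widehat f$ has compact support, the integral $$h(t)=\frac1{(2\pi)^n}\int_{\mathbb R^n}\widehat f(\xi)\,h_\xi(t)\,d\xi$$ converges absolutely for every $t\in\mathbb R^\ell$, the function $h:\mathbb R^\ell\to\mathbb C$ is real analytic, and $f(x)=h(\rho_1(x),\dots,\rho_\ell(x))$ for almost every $x\in\mathbb R^n$, hence for every $x$ if $f$ is taken to be continuous. -/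

import Mathlib

open MeasureTheory

/-- Euclidean space `ℝⁿ`. -/
abbrev Euc (n : ℕ) : Type := EuclideanSpace ℝ (Fin n)

/-- The algebra `𝒫(ℝⁿ)^K` of real polynomials that are invariant under the orthogonal
action `π` of `K` on `ℝⁿ`. -/
def invariantPolynomials {n : ℕ} {K : Type*} [Group K] (π : K →* (Euc n ≃ₗᵢ[ℝ] Euc n)) :
    Subalgebra ℝ (MvPolynomial (Fin n) ℝ) where
  carrier := {p | ∀ (k : K) (x : Euc n),
    MvPolynomial.eval (fun i => π k x i) p = MvPolynomial.eval (fun i => x i) p}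
  mul_mem' := by
    intro p q hp hq k x
    simp only [map_mul, hp k x, hq k x]
  add_mem' := by
    intro p q hp hq k x
    simp only [map_add, hp k x, hq k x]
  algebraMap_mem' := by
    intro r k x
    simp [MvPolynomial.algebraMap_eq]

/-- The map `ρ = (ρ₁, …, ρ_ℓ) : ℝⁿ → ℝ^ℓ`. -/
noncomputable def polyMap {n l : ℕ} (ρ : Fin l → MvPolynomial (Fin n) ℝ) (x : Euc n) :
    Fin l → ℝ :=
  fun j => MvPolynomial.eval (fun i => x i) (ρ j)

/-- The Fourier transform `f̂(ξ) = ∫ f(x) e^{-i⟨x,ξ⟩} dx`. -/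
noncomputable def fourierHat {n : ℕ} (f : Euc n → ℂ) (ξ : Euc n) : ℂ :=
  ∫ x : Euc n, f x * Complex.exp (-(Complex.I * ((inner ℝ x ξ : ℝ) : ℂ)))

/-- The bounded spherical function `φ_ξ(x) = ∫_K e^{i⟨x, k·ξ⟩} dk`, where `dk` is the Haar
measure of total mass one on the compact group `K`. -/
noncomputable def spherical {n : ℕ} {K : Type*} [Group K] [TopologicalSpace K]
    [IsTopologicalGroup K] [CompactSpace K] [MeasurableSpace K] [BorelSpace K]
    (π : K →* (Euc n ≃ₗᵢ[ℝ] Euc n)) (ξ x : Euc n) : ℂ :=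
  ∫ k : K, Complex.exp (Complex.I * ((inner ℝ x (π k ξ) : ℝ) : ℂ))
    ∂(Measure.haarMeasure (⊤ : TopologicalSpace.PositiveCompacts K))

/-- The degree-`m` homogeneous term of the Taylor expansion at the origin of `φ`,
evaluated at `x`: the coefficient of `s ^ m` in the Taylor series of `s ↦ φ (s x)`. -/
noncomputable def taylorTerm {n : ℕ} (φ : Euc n → ℂ) (m : ℕ) (x : Euc n) : ℂ :=
  iteratedDeriv m (fun s : ℝ => φ (s • x)) 0 / (m.factorial : ℂ)

/-- `|J|_ρ = j₁ deg ρ₁ + ⋯ + j_ℓ deg ρ_ℓ`. -/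
def weightedDegree {n l : ℕ} (ρ : Fin l → MvPolynomial (Fin n) ℝ) (J : Fin l → ℕ) : ℕ :=
  ∑ j, J j * (ρ j).totalDegree

/-- The coefficient `a_{J,ξ} = q_J(ρ₁(ξ), …, ρ_ℓ(ξ))`, for a family `q` of complex
polynomials in `ℓ` variables. -/
noncomputable def coeffAt {n l : ℕ} (ρ : Fin l → MvPolynomial (Fin n) ℝ)
    (q : (Fin l → ℕ) → MvPolynomial (Fin l) ℂ) (ξ : Euc n) (J : Fin l → ℕ) : ℂ :=
  MvPolynomial.eval (fun j => ((polyMap ρ ξ j : ℝ) : ℂ)) (q J)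

/-- The monomial `t^J = t₁^{j₁} ⋯ t_ℓ^{j_ℓ}`, as a complex number. -/
noncomputable def monomialAt {l : ℕ} (t : Fin l → ℝ) (J : Fin l → ℕ) : ℂ :=
  ∏ j, ((t j : ℝ) : ℂ) ^ J j

/-- The polynomials `q_J` expand the spherical functions in the generators: for every `m`
the degree-`m` Taylor term of `φ_ξ` is the sum of `q_J(ρ(ξ)) ρ(x)^J` over `|J|_ρ = m`.
(The sum is finite when no `ρ_j` is constant.) -/
def IsSphericalExpansion {n l : ℕ} {K : Type*} [Group K] [TopologicalSpace K]
    [IsTopologicalGroup K] [CompactSpace K] [MeasurableSpace K] [BorelSpace K]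
    (π : K →* (Euc n ≃ₗᵢ[ℝ] Euc n)) (ρ : Fin l → MvPolynomial (Fin n) ℝ)
    (q : (Fin l → ℕ) → MvPolynomial (Fin l) ℂ) : Prop :=
  ∀ (ξ : Euc n) (m : ℕ) (x : Euc n),
    HasSum (fun J : {J : Fin l → ℕ // weightedDegree ρ J = m} =>
        coeffAt ρ q ξ J.1 * monomialAt (polyMap ρ x) J.1)
      (taylorTerm (spherical π ξ) m x)

/-- `h(t) = ∫ f̂(ξ) h_ξ(t) dξ`, where `dξ` is Lebesgue measure divided by `(2π)ⁿ`. -/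
noncomputable def bandLimitedLift {n l : ℕ} (H : Euc n → (Fin l → ℝ) → ℂ)
    (f : Euc n → ℂ) (t : Fin l → ℝ) : ℂ :=
  (((2 * Real.pi) ^ n : ℝ) : ℂ)⁻¹ * ∫ ξ : Euc n, fourierHat f ξ * H ξ t

/-! Expanding the exponential gives `φ_ξ(x) = ∑ i^m/m! ∫_K ⟨x, kξ⟩^m dk`. Each moment is an
invariant homogeneous polynomial in `x`, hence a polynomial in the generators. The difficulty is to
choose these polynomials with coefficients growing at most exponentially in `m`, so that `1/m!`
makes the series in `t` converge on all of `ℝ^ℓ`.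

The choice is made by one linear map (`exists_bounded_lift`). In `ℝ[x,t]`, take lexicographic normal
forms modulo the kernel of `x ↦ x, t_j ↦ τ_j`, with the `x` variables above the `t` variables. The
normal form of an invariant then involves `t` alone and is a lift of it. Only finitely many
reduction rules are needed, and suitable weights make each replacement no larger than the monomial
it replaces, so normal forms never increase a weighted `ℓ¹`-norm (`exists_normalForm`).

Applied to the moments, this bounds the weight-`m` part by `(B‖ξ‖)^m/m!`
(`exists_sphericalMoment_expansion`). Hence `h_ξ(t)` is dominated by an exponential in `‖ξ‖`, and
integration against a compactly supported `f̂` may be done term by term, giving another everywhere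
convergent power series. Fourier inversion, with exponentials averaged over `K`, identifies it with
`f` on the image of `ρ`. General generators reduce to homogeneous ones through their homogeneous
components. -/

open MvPolynomial in
/-- The weighted `ℓ¹`-norm `∑ |p_a| r^a` of a real polynomial. -/
noncomputable def polyNorm {σ : Type*} [Fintype σ] (r : σ → ℝ) (p : MvPolynomial σ ℝ) : ℝ :=
  ∑ a ∈ p.support, |p.coeff a| * ∏ i, r i ^ a i

/-! ### Weighted `ℓ¹`-norms of polynomials -/

section PolyNorm

open MvPolynomial

variable {σ : Type*} [Fintype σ]

theorem polyNorm_eq_sum_of_subset (r : σ → ℝ) (p : MvPolynomial σ ℝ) {S : Finset (σ →₀ ℕ)}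
    (h : p.support ⊆ S) : polyNorm r p = ∑ a ∈ S, |p.coeff a| * ∏ i, r i ^ a i := by
  refine Finset.sum_subset h fun a _ ha => ?_
  rw [MvPolynomial.notMem_support_iff.1 ha]
  simp

theorem polyNorm_zero (r : σ → ℝ) : polyNorm r 0 = 0 := by
  simp [polyNorm]

theorem polyNorm_add_le {r : σ → ℝ} (hr : ∀ i, 0 < r i) (p q : MvPolynomial σ ℝ) :
    polyNorm r (p + q) ≤ polyNorm r p + polyNorm r q := by
  classical
  have h1 : (p + q).support ⊆ p.support ∪ q.support := MvPolynomial.support_add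
  rw [polyNorm_eq_sum_of_subset r _ h1,
    polyNorm_eq_sum_of_subset r p (S := p.support ∪ q.support) Finset.subset_union_left,
    polyNorm_eq_sum_of_subset r q (S := p.support ∪ q.support) Finset.subset_union_right,
    ← Finset.sum_add_distrib]
  refine Finset.sum_le_sum fun a _ => ?_
  rw [← add_mul, coeff_add]
  exact mul_le_mul_of_nonneg_right (abs_add_le _ _)
    (Finset.prod_nonneg fun i _ => (pow_pos (hr i) _).le)

theorem polyNorm_smul (r : σ → ℝ) (c : ℝ) (p : MvPolynomial σ ℝ) :
    polyNorm r (c • p) = |c| * polyNorm r p := by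
  rw [polyNorm_eq_sum_of_subset r _ (S := p.support) MvPolynomial.support_smul, polyNorm,
    Finset.mul_sum]
  refine Finset.sum_congr rfl fun a _ => ?_
  rw [coeff_smul, smul_eq_mul, abs_mul, mul_assoc]

theorem polyNorm_sum_le {r : σ → ℝ} (hr : ∀ i, 0 < r i) {ι : Type*} (S : Finset ι)
    (p : ι → MvPolynomial σ ℝ) : polyNorm r (∑ i ∈ S, p i) ≤ ∑ i ∈ S, polyNorm r (p i) := by
  classical
  induction S using Finset.induction_on with
  | empty => simp [polyNorm_zero]
  | insert i S hi ih =>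
    rw [Finset.sum_insert hi, Finset.sum_insert hi]
    exact (polyNorm_add_le hr _ _).trans (by gcongr)

theorem polyNorm_monomial_one (r : σ → ℝ) (a : σ →₀ ℕ) :
    polyNorm r (monomial a 1) = ∏ i, r i ^ a i := by
  classical
  rw [polyNorm_eq_sum_of_subset r _ (S := {a}) support_monomial_subset]
  simp

theorem sum_abs_coeff_le_polyNorm {r : σ → ℝ} (hr : ∀ i, 0 < r i) (p : MvPolynomial σ ℝ)
    (S : Finset (σ →₀ ℕ)) : ∑ a ∈ S, |p.coeff a| * ∏ i, r i ^ a i ≤ polyNorm r p := by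
  classical
  rw [polyNorm_eq_sum_of_subset r p (S := p.support ∪ S) Finset.subset_union_left]
  refine Finset.sum_le_sum_of_subset_of_nonneg Finset.subset_union_right fun a _ _ => ?_
  exact mul_nonneg (abs_nonneg _) (Finset.prod_nonneg fun i _ => (pow_pos (hr i) _).le)

theorem polyNorm_map_le {τ : Type*} [Fintype τ] {r : σ → ℝ} {s : τ → ℝ}
    (hs : ∀ i, 0 < s i) (T : MvPolynomial σ ℝ →ₗ[ℝ] MvPolynomial τ ℝ)
    (hT : ∀ a, polyNorm s (T (monomial a 1)) ≤ ∏ i, r i ^ a i) (p : MvPolynomial σ ℝ) :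
    polyNorm s (T p) ≤ polyNorm r p := by
  conv_lhs => rw [p.as_sum]
  rw [map_sum]
  refine (polyNorm_sum_le hs _ _).trans (Finset.sum_le_sum fun a _ => ?_)
  have : monomial a (p.coeff a) = p.coeff a • monomial a (1 : ℝ) := by
    rw [smul_monomial, smul_eq_mul, mul_one]
  rw [this, map_smul, polyNorm_smul]
  exact mul_le_mul_of_nonneg_left (hT a) (abs_nonneg _)

end PolyNorm

/-! ### Norm-decreasing lexicographic normal forms -/

section NormalForm

open MvPolynomial MonomialOrder

variable {σ : Type*} [Fintype σ] [LinearOrder σ]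

/-- In base `M`, a lexicographically larger exponent vector with entries below `M` represents
a larger number. -/
theorem sum_pow_lt_of_lex_lt (M : ℕ) {a b : σ →₀ ℕ} (ha : ∀ i, a i < M) (h : a ≺[lex] b) :
    ∑ i, M ^ (Finset.univ.filter (i < ·)).card * a i <
      ∑ i, M ^ (Finset.univ.filter (i < ·)).card * b i := by
  rw [MonomialOrder.lex_lt_iff, Finsupp.Lex.lt_iff] at h
  obtain ⟨i, hi, hlt⟩ := h
  simp only [ofLex_toLex] at hi hlt
  -- Place values: the smallest index is the most significant digit, as in the lexicographic order.
  set e : σ → ℕ := fun i => (Finset.univ.filter (i < ·)).card with he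
  have hanti : StrictAnti e := by
    intro j k hjk
    apply Finset.card_lt_card
    refine ⟨fun x hx => ?_, fun hx => ?_⟩
    · simp only [Finset.mem_filter, Finset.mem_univ, true_and] at hx ⊢
      exact hjk.trans hx
    · have := hx (show k ∈ _ by simpa using hjk)
      simp at this
  have hsplit : ∀ c : σ →₀ ℕ, ∑ j, M ^ e j * c j =
      ∑ j ∈ Finset.univ.filter (· < i), M ^ e j * c j + M ^ e i * c i +
        ∑ j ∈ Finset.univ.filter (i < ·), M ^ e j * c j := by
    intro c
    have h2 : (Finset.univ.filter fun j => ¬ j < i) = insert i (Finset.univ.filter (i < ·)) := by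
      ext j
      simp only [Finset.mem_filter, Finset.mem_univ, true_and, Finset.mem_insert, not_lt]
      exact ⟨fun h => h.eq_or_lt.imp Eq.symm id, fun h => h.elim (fun h => h.ge) le_of_lt⟩
    rw [← Finset.sum_filter_add_sum_filter_not Finset.univ (· < i), h2,
      Finset.sum_insert (by simp), add_assoc]
  have htail : ∑ j ∈ Finset.univ.filter (i < ·), M ^ e j * a j < M ^ e i := by
    have hM : 1 ≤ M := (Nat.zero_le _).trans_lt (ha i)
    calc ∑ j ∈ Finset.univ.filter (i < ·), M ^ e j * a j
        ≤ ∑ j ∈ Finset.univ.filter (i < ·), M ^ e j * (M - 1) :=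
          Finset.sum_le_sum fun j _ => Nat.mul_le_mul_left _ (Nat.le_sub_one_of_lt (ha j))
      _ = ∑ k ∈ (Finset.univ.filter (i < ·)).image e, M ^ k * (M - 1) := by
          rw [Finset.sum_image fun x _ y _ h => hanti.injective h]
      _ ≤ ∑ k ∈ Finset.range (e i), M ^ k * (M - 1) := by
          refine Finset.sum_le_sum_of_subset fun k hk => ?_
          obtain ⟨j, hj, rfl⟩ := Finset.mem_image.1 hk
          exact Finset.mem_range.2 (hanti (Finset.mem_filter.1 hj).2)
      _ < M ^ e i := by
          rw [← Finset.sum_mul]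
          have h3 : (∑ k ∈ Finset.range (e i), M ^ k) * (M - 1) + 1 = M ^ e i := by
            have := geom_sum_mul_add (M - 1) (e i)
            rwa [Nat.sub_add_cancel hM] at this
          omega
  rw [hsplit a, hsplit b, Finset.sum_congr rfl fun j hj => by rw [hi j (Finset.mem_filter.1 hj).2]]
  have h4 : M ^ e i * (a i + 1) ≤ M ^ e i * b i := Nat.mul_le_mul_left _ hlt
  rw [mul_add, mul_one] at h4
  omega

/-- Finitely many polynomials whose exponents are lexicographically below prescribed ones can be
made small relative to the corresponding monomials by a choice of weights. -/
theorem exists_polyNorm_le_of_lex_lt {B : Type*} [Finite B] (b : B → σ →₀ ℕ)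
    (u : B → MvPolynomial σ ℝ) (hu : ∀ k, ∀ a ∈ (u k).support, a ≺[lex] b k) :
    ∃ r : σ → ℝ, (∀ i, 0 < r i) ∧ ∀ k, polyNorm r (u k) ≤ ∏ i, r i ^ b k i := by
  classical
  cases nonempty_fintype B
  obtain ⟨M, hM⟩ : ∃ M : ℕ, ∀ k, ∀ a ∈ (u k).support, ∀ i, a i < M := by
    refine ⟨∑ k, ∑ a ∈ (u k).support, ∑ i, a i + 1, fun k a ha i => Nat.lt_succ_of_le ?_⟩
    calc a i ≤ ∑ i, a i := Finset.single_le_sum (f := fun i => a i) (by simp) (Finset.mem_univ i)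
      _ ≤ ∑ a ∈ (u k).support, ∑ i, a i :=
        Finset.single_le_sum (f := fun a : σ →₀ ℕ => ∑ i, a i) (by simp) ha
      _ ≤ _ := Finset.single_le_sum (f := fun k => ∑ a ∈ (u k).support, ∑ i, a i) (by simp)
        (Finset.mem_univ k)
  obtain ⟨T, hT1, hT⟩ : ∃ T : ℝ, 1 ≤ T ∧ ∀ k, ∑ a ∈ (u k).support, |(u k).coeff a| ≤ T := by
    refine ⟨1 + ∑ k, ∑ a ∈ (u k).support, |(u k).coeff a|, ?_, fun k => ?_⟩
    · have : 0 ≤ ∑ k, ∑ a ∈ (u k).support, |(u k).coeff a| := by positivity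
      linarith
    · have := Finset.single_le_sum (f := fun k => ∑ a ∈ (u k).support, |(u k).coeff a|)
        (fun k _ => by positivity) (Finset.mem_univ k)
      linarith
  have hT0 : 0 < T := by linarith
  -- With weights `T ^ w i`, a strict lexicographic drop gains at least one factor `T`, which
  -- absorbs the sum of the coefficients.
  set w : σ → ℕ := fun i => M ^ (Finset.univ.filter (i < ·)).card
  have hw : ∀ c : σ →₀ ℕ, ∏ i, (T ^ w i) ^ c i = T ^ ∑ i, w i * c i := fun c => by
    simp_rw [← pow_mul, Finset.prod_pow_eq_pow_sum]
  refine ⟨fun i => T ^ w i, fun i => pow_pos hT0 _, fun k => ?_⟩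
  rw [polyNorm, hw]
  rcases (u k).support.eq_empty_or_nonempty with h0 | ⟨a₀, ha₀⟩
  · rw [h0, Finset.sum_empty]; positivity
  have hpos : 1 ≤ ∑ i, w i * b k i :=
    (Nat.zero_le _).trans_lt (sum_pow_lt_of_lex_lt M (hM k a₀ ha₀) (hu k a₀ ha₀))
  calc ∑ a ∈ (u k).support, |(u k).coeff a| * ∏ i, (T ^ w i) ^ a i
      ≤ ∑ a ∈ (u k).support, |(u k).coeff a| * T ^ (∑ i, w i * b k i - 1) := by
        refine Finset.sum_le_sum fun a ha => mul_le_mul_of_nonneg_left ?_ (abs_nonneg _)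
        rw [hw]
        exact pow_le_pow_right₀ hT1
          (Nat.le_sub_one_of_lt (sum_pow_lt_of_lex_lt M (hM k a ha) (hu k a ha)))
    _ ≤ T * T ^ (∑ i, w i * b k i - 1) := by
        rw [← Finset.sum_mul]
        exact mul_le_mul_of_nonneg_right (hT k) (by positivity)
    _ = T ^ ∑ i, w i * b k i := by rw [← pow_succ', Nat.sub_add_cancel hpos]

/-- Normal forms modulo an ideal, for the lexicographic order, do not increase a suitable
weighted `ℓ¹`-norm. -/
theorem exists_normalForm (L : Ideal (MvPolynomial σ ℝ)) :
    ∃ (r : σ → ℝ) (N : MvPolynomial σ ℝ →ₗ[ℝ] MvPolynomial σ ℝ), (∀ i, 0 < r i) ∧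
      (∀ p, p - N p ∈ L) ∧ (∀ p ∈ L, N p = 0) ∧
      (∀ a, ∀ c ∈ (N (monomial a 1)).support, c ≼[lex] a) ∧
      ∀ a, polyNorm r (N (monomial a 1)) ≤ ∏ i, r i ^ a i := by
  classical
  let m : MonomialOrder σ := lex
  -- `E` is the set of leading exponents of `L`. By Dickson's lemma its minimal elements `B` are
  -- finite in number, so one choice of weights can serve all the rules `x^b ≡ u b`.
  let E : Set (σ →₀ ℕ) := {a | ∃ f ∈ L, f ≠ 0 ∧ m.degree f = a}
  let B : Set (σ →₀ ℕ) := {a | Minimal (· ∈ E) a}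
  have hB : B.Finite := by
    have h1 : IsAntichain (· ≤ ·) B := setOfPred_minimal_antichain _
    exact (WellQuasiOrderedLE.finite_of_isAntichain h1)
  have hu : ∀ b : B, ∃ u : MvPolynomial σ ℝ, (∀ a ∈ u.support, a ≺[lex] b.1) ∧
      monomial b.1 1 - u ∈ L := by
    rintro ⟨b, hb⟩
    obtain ⟨f, hf, hf0, hfb⟩ := hb.1
    refine ⟨monomial b 1 - C (m.leadingCoeff f)⁻¹ * f, fun a ha => ?_, ?_⟩
    · have hl : m.leadingCoeff f ≠ 0 := m.leadingCoeff_ne_zero_iff.2 hf0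
      rw [mem_support_iff, coeff_sub, coeff_monomial, coeff_C_mul] at ha
      have hab : b ≠ a := by
        rintro rfl
        apply ha
        rw [if_pos rfl, ← hfb]
        have : coeff (m.degree f) f = m.leadingCoeff f := rfl
        rw [this, inv_mul_cancel₀ hl, sub_self]
      rw [if_neg hab, zero_sub, neg_ne_zero] at ha
      have : a ∈ f.support := mem_support_iff.2 (right_ne_zero_of_mul ha)
      have h2 := m.le_degree this
      rw [hfb] at h2
      exact lt_of_le_of_ne h2 fun h => hab (m.toSyn.injective h).symm
    · rw [sub_sub_cancel]
      exact L.mul_mem_left _ hf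
  choose u hu1 hu2 using hu
  have : Finite B := hB
  obtain ⟨r, hr, hru⟩ := exists_polyNorm_le_of_lex_lt (fun b : B => b.1) u hu1
  -- Well-founded induction on the exponent. If `a = b + g` is reducible, `x^a` is congruent to `x^g
  -- * u b`, whose monomials are strictly smaller and whose norm is at most that of `x^a`.
  have key : ∀ a : σ →₀ ℕ, ∃ p : MvPolynomial σ ℝ, monomial a 1 - p ∈ L ∧
      (∀ c ∈ p.support, c ∉ E ∧ c ≼[lex] a) ∧ polyNorm r p ≤ ∏ i, r i ^ a i := by
    intro a
    induction ha : m.toSyn a using WellFoundedLT.induction generalizing a with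
    | ind s ih =>
    subst ha
    by_cases haE : a ∈ E
    · obtain ⟨b, hba, hb⟩ := exists_minimal_le_of_wellFoundedLT (· ∈ E) a haE
      obtain ⟨g, rfl⟩ := exists_add_of_le hba
      let b' : B := ⟨b, hb⟩
      have hlt : ∀ c ∈ (u b').support, (c + g) ≺[lex] (b + g) := fun c hc => by
        have := hu1 b' c hc
        rw [map_add, map_add]
        exact add_lt_add_left this _
      have ih' : ∀ c ∈ (u b').support, ∃ p : MvPolynomial σ ℝ, monomial (c + g) 1 - p ∈ L ∧
          (∀ c' ∈ p.support, c' ∉ E ∧ c' ≼[lex] (c + g)) ∧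
          polyNorm r p ≤ ∏ i, r i ^ (c + g) i := fun c hc => ih _ (hlt c hc) _ rfl
      choose! q hq1 hq2 hq3 using ih'
      refine ⟨∑ c ∈ (u b').support, (u b').coeff c • q c, ?_, fun c hc => ?_, ?_⟩
      · have h1 : monomial (b + g) 1 - ∑ c ∈ (u b').support, (u b').coeff c • q c =
            monomial g 1 * (monomial b 1 - u b') +
              ∑ c ∈ (u b').support, C ((u b').coeff c) * (monomial (c + g) 1 - q c) := by
          have h2 : monomial g 1 * u b' =
              ∑ c ∈ (u b').support, C ((u b').coeff c) * monomial (c + g) 1 := by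
            conv_lhs => rw [(u b').as_sum, Finset.mul_sum]
            refine Finset.sum_congr rfl fun c _ => ?_
            rw [monomial_mul, C_mul_monomial, add_comm, one_mul, mul_one]
          simp_rw [mul_sub, Finset.sum_sub_distrib, h2, monomial_mul, mul_one, add_comm g b,
            smul_eq_C_mul]
          ring
        rw [h1]
        exact L.add_mem (L.mul_mem_left _ (hu2 b'))
          (L.sum_mem fun c hc => L.mul_mem_left _ (hq1 c hc))
      · obtain ⟨d, hd, hcd⟩ := Finset.mem_biUnion.1 (support_sum hc)
        have h3 := hq2 d hd c (support_smul hcd)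
        exact ⟨h3.1, h3.2.trans (hlt d hd).le⟩
      · refine (polyNorm_sum_le hr _ _).trans ?_
        calc ∑ c ∈ (u b').support, polyNorm r ((u b').coeff c • q c)
            ≤ ∑ c ∈ (u b').support, |(u b').coeff c| * ((∏ i, r i ^ c i) * ∏ i, r i ^ g i) := by
              refine Finset.sum_le_sum fun c hc => ?_
              rw [polyNorm_smul, ← Finset.prod_mul_distrib]
              refine mul_le_mul_of_nonneg_left ((hq3 c hc).trans_eq ?_) (abs_nonneg _)
              exact Finset.prod_congr rfl fun i _ => by rw [Finsupp.add_apply, pow_add]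
          _ = polyNorm r (u b') * ∏ i, r i ^ g i := by
              rw [polyNorm, Finset.sum_mul]
              exact Finset.sum_congr rfl fun c _ => by ring
          _ ≤ (∏ i, r i ^ b i) * ∏ i, r i ^ g i :=
              mul_le_mul_of_nonneg_right (hru b')
                (Finset.prod_nonneg fun i _ => (pow_pos (hr i) _).le)
          _ = ∏ i, r i ^ (b + g) i := by
              rw [← Finset.prod_mul_distrib]
              exact Finset.prod_congr rfl fun i _ => by rw [Finsupp.add_apply, pow_add]
    · refine ⟨monomial a 1, by simp, fun c hc => ?_, (polyNorm_monomial_one r a).le⟩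
      have : c = a := by simpa using support_monomial_subset hc
      subst this
      exact ⟨haE, le_rfl⟩
  choose F hF1 hF2 hF3 using key
  let N := (basisMonomials σ ℝ).constr ℝ F
  have hN : ∀ a, N (monomial a 1) = F a := fun a => by
    have := (basisMonomials σ ℝ).constr_basis ℝ F a
    rwa [coe_basisMonomials] at this
  have hNsum : ∀ p, N p = ∑ a ∈ p.support, p.coeff a • F a := fun p => by
    conv_lhs => rw [p.as_sum, map_sum]
    refine Finset.sum_congr rfl fun a _ => ?_
    rw [← hN, ← map_smul, smul_monomial, smul_eq_mul, mul_one]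
  have hsub : ∀ p, p - N p ∈ L := fun p => by
    have : p - N p = ∑ a ∈ p.support, C (p.coeff a) * (monomial a 1 - F a) := by
      simp_rw [hNsum, mul_sub, Finset.sum_sub_distrib, smul_eq_C_mul, C_mul_monomial, mul_one]
      rw [← p.as_sum]
    rw [this]
    exact L.sum_mem fun a _ => L.mul_mem_left _ (hF1 a)
  refine ⟨r, N, hr, hsub, fun p hp => ?_, fun a c hc => ?_, fun a => ?_⟩
  -- A nonzero normal form lying in `L` would have its leading exponent in `E`, which the support of
  -- every normal form avoids.
  · by_contra h0
    have h1 : N p ∈ L := by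
      have := L.sub_mem hp (hsub p)
      rwa [sub_sub_cancel] at this
    have h2 : m.degree (N p) ∈ (N p).support := m.degree_mem_support h0
    have h3 := h2
    rw [hNsum p] at h3
    obtain ⟨d, hd, hcd⟩ := Finset.mem_biUnion.1 (support_sum h3)
    rw [← hNsum p] at hcd
    exact (hF2 d _ (support_smul hcd)).1 ⟨N p, h1, h0, rfl⟩
  · rw [hN] at hc
    exact (hF2 a c hc).2
  · rw [hN]
    exact hF3 a

end NormalForm

/-! ### Elimination: a linear lift through the generators with bounded coefficients -/

section BoundedLift

open MvPolynomial MonomialOrder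

/-- Polynomials in the subalgebra generated by `τ` can be written as polynomials in `τ` linearly
and with exponentially bounded coefficients. -/
theorem exists_bounded_lift {n l : ℕ} (τ : Fin l → MvPolynomial (Fin n) ℝ) :
    ∃ (r : Fin n → ℝ) (s : Fin l → ℝ)
      (N : MvPolynomial (Fin n) ℝ →ₗ[ℝ] MvPolynomial (Fin l) ℝ),
      (∀ i, 0 < r i) ∧ (∀ j, 0 < s j) ∧
      (∀ p ∈ Algebra.adjoin ℝ (Set.range τ), aeval τ (N p) = p) ∧
      ∀ a, polyNorm s (N (monomial a 1)) ≤ ∏ i, r i ^ a i := by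
  classical
  let Φ : MvPolynomial (Fin (n + l)) ℝ →ₐ[ℝ] MvPolynomial (Fin n) ℝ :=
    aeval (Fin.addCases X τ)
  let Ψ : MvPolynomial (Fin (n + l)) ℝ →ₐ[ℝ] MvPolynomial (Fin l) ℝ :=
    aeval (Fin.addCases (fun _ => 0) X)
  let incl : MvPolynomial (Fin n) ℝ →ₐ[ℝ] MvPolynomial (Fin (n + l)) ℝ := rename (Fin.castAdd l)
  have hΦincl : ∀ p, Φ (incl p) = p := fun p => by
    simp only [Φ, incl, aeval_rename]
    convert aeval_X_left_apply p using 2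
    congr 1
    ext1 i
    simp
  have hΦinr : ∀ F, Φ (rename (Fin.natAdd n) F) = aeval τ F := fun F => by
    simp only [Φ, aeval_rename]
    congr 2
    ext1 i
    simp
  have hΨ : ∀ c : Fin (n + l) →₀ ℕ, (∀ i, c (Fin.castAdd l i) = 0) →
      Ψ (monomial c 1) = monomial (Finsupp.equivFunOnFinite.symm fun j => c (Fin.natAdd n j)) 1 ∧
        aeval τ (Ψ (monomial c 1)) = Φ (monomial c 1) := by
    intro c hc
    have h1 : Ψ (monomial c 1) = ∏ j, X j ^ c (Fin.natAdd n j) := by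
      simp only [Ψ, aeval_monomial, map_one, one_mul]
      rw [Finsupp.prod_fintype _ _ (by simp), Fin.prod_univ_add]
      simp [hc]
    refine ⟨?_, ?_⟩
    · rw [h1, monomial_eq, C_1, one_mul, Finsupp.prod_fintype _ _ (by simp)]
      simp
    · rw [h1]
      simp only [Φ, aeval_monomial, map_one, one_mul, map_prod, map_pow, aeval_X]
      rw [Finsupp.prod_fintype _ _ (by simp), Fin.prod_univ_add]
      simp [hc]
  obtain ⟨r, N, hr, hN1, hN2, hN3, hN4⟩ :=
    exists_normalForm (RingHom.ker Φ : Ideal (MvPolynomial (Fin (n + l)) ℝ))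
  -- Elimination property: the first `n` indices dominate, so an exponent lexicographically below
  -- one free of `x` is itself free of `x`.
  have hN5 : ∀ F c, c ∈ (N (rename (Fin.natAdd n) F)).support → ∀ i, c (Fin.castAdd l i) = 0 := by
    intro F c hc i
    have h1 : N (rename (Fin.natAdd n) F) =
        ∑ d ∈ F.support, F.coeff d • N (monomial (d.mapDomain (Fin.natAdd n)) 1) := by
      conv_lhs => rw [F.as_sum, map_sum, map_sum]
      refine Finset.sum_congr rfl fun d _ => ?_
      rw [rename_monomial, ← map_smul, smul_monomial, smul_eq_mul, mul_one]
    rw [h1] at hc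
    obtain ⟨d, -, hcd⟩ := Finset.mem_biUnion.1 (support_sum hc)
    have h2 := hN3 _ c (support_smul hcd)
    have h3 : ∀ i, d.mapDomain (Fin.natAdd n) (Fin.castAdd l i) = 0 := fun i => by
      refine Finsupp.mapDomain_of_notMem_range _ _ ?_
      rintro ⟨j, hj⟩
      have := congrArg Fin.val hj
      simp at this
      omega
    rcases h2.eq_or_lt with h2 | h2
    · rw [(lex (σ := Fin (n + l))).toSyn.injective h2, h3]
    · rw [MonomialOrder.lex_lt_iff, Finsupp.Lex.lt_iff] at h2
      obtain ⟨k, hk, hlt⟩ := h2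
      simp only [ofLex_toLex] at hk hlt
      induction k using Fin.addCases with
      | left k => rw [h3] at hlt; exact absurd hlt (Nat.not_lt_zero _)
      | right k =>
        rw [hk _ (by rw [Fin.lt_def]; simp; omega), h3]
  have hs : ∀ j, 0 < r (Fin.natAdd n j) := fun j => hr _
  refine ⟨fun i => r (Fin.castAdd l i), fun j => r (Fin.natAdd n j),
    Ψ.toLinearMap ∘ₗ N ∘ₗ incl.toLinearMap, fun i => hr _, hs, fun p hp => ?_, fun a => ?_⟩
  · rw [Algebra.adjoin_range_eq_range_aeval] at hp
    obtain ⟨F, rfl⟩ := hp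
    simp only [LinearMap.comp_apply, AlgHom.toLinearMap_apply]
    -- The polynomials `F(τ(x))` and `F(t)` have the same image under `Φ`, hence the same normal
    -- form, and the latter's contains no `x`.
    have h1 : N (incl (aeval τ F)) = N (rename (Fin.natAdd n) F) := by
      rw [← sub_eq_zero, ← map_sub]
      refine hN2 _ ?_
      rw [RingHom.mem_ker, map_sub, hΦincl, hΦinr, sub_self]
    have h2 : Φ (N (rename (Fin.natAdd n) F)) = aeval τ F := by
      have := hN1 (rename (Fin.natAdd n) F)
      rw [RingHom.mem_ker, map_sub, hΦinr, sub_eq_zero] at this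
      exact this.symm
    refine (congrArg (fun q => aeval τ (Ψ q)) h1).trans (Eq.trans ?_ h2)
    conv_lhs => rw [(N (rename (Fin.natAdd n) F)).as_sum]
    conv_rhs => rw [(N (rename (Fin.natAdd n) F)).as_sum]
    simp only [map_sum]
    refine Finset.sum_congr rfl fun c hc => ?_
    have h3 : monomial c (coeff c (N (rename (Fin.natAdd n) F))) =
        coeff c (N (rename (Fin.natAdd n) F)) • monomial c (1 : ℝ) := by
      rw [smul_monomial, smul_eq_mul, mul_one]
    rw [h3, map_smul, map_smul, map_smul, (hΨ c (hN5 F c hc)).2]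
  · simp only [LinearMap.comp_apply, AlgHom.toLinearMap_apply, incl, rename_monomial]
    refine (polyNorm_map_le (r := r) hs Ψ.toLinearMap (fun c => ?_) _).trans ((hN4 _).trans_eq ?_)
    · rw [AlgHom.toLinearMap_apply]
      by_cases hc : ∀ i, c (Fin.castAdd l i) = 0
      · rw [(hΨ c hc).1, polyNorm_monomial_one, Fin.prod_univ_add]
        simp [hc]
      · push Not at hc
        obtain ⟨i, hi⟩ := hc
        have : Ψ (monomial c 1) = 0 := by
          simp only [Ψ, aeval_monomial, map_one, one_mul]
          rw [Finsupp.prod_fintype _ _ (by simp)]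
          exact Finset.prod_eq_zero (Finset.mem_univ (Fin.castAdd l i)) (by simp [hi])
        rw [this, polyNorm_zero]
        exact Finset.prod_nonneg fun i _ => (pow_pos (hr i) _).le
    · rw [Fin.prod_univ_add]
      have h1 : ∀ i, a.mapDomain (Fin.castAdd l) (Fin.castAdd l i) = a i := fun i =>
        Finsupp.mapDomain_apply (Fin.castAdd_injective n l) _ _
      have h2 : ∀ j, a.mapDomain (Fin.castAdd l) (Fin.natAdd n j) = 0 := fun j => by
        refine Finsupp.mapDomain_of_notMem_range _ _ ?_
        rintro ⟨i, hi⟩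
        have := congrArg Fin.val hi
        simp at this
        omega
      simp [h1, h2]

end BoundedLift

/-! ### Analyticity of everywhere convergent multivariate power series -/

section PowerSeries

theorem HasSum.fiberwise {α E : Type*} [NormedAddCommGroup E] {f : α → E}
    {a : E} (h : HasSum f a) (d : α → ℕ) {g : ℕ → E}
    (hg : ∀ m, HasSum (fun J : {J // d J = m} => f J.1) (g m)) : HasSum g a :=
  HasSum.sigma ((Equiv.sigmaFiberEquiv d).hasSum_iff.2 h) hg

/-- Spelling an exponent vector as a word makes the monomial the diagonal value of a multilinear
map. -/
theorem exists_word_prod_eq {l m : ℕ} (J : Fin l → ℕ) (hJ : ∑ j, J j = m) :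
    ∃ w : Fin m → Fin l, ∀ f : Fin l → ℂ, ∏ i, f (w i) = ∏ j, f j ^ J j := by
  let S : Multiset (Fin l) := ∑ j, J j • {j}
  have hlen : S.toList.length = m := by
    simp [S, hJ]
  subst hlen
  refine ⟨S.toList.get, fun f => ?_⟩
  have h1 : ∏ i, f (S.toList.get i) = (S.map f).prod := by
    conv_rhs => rw [← Multiset.coe_toList S, Multiset.map_coe, Multiset.prod_coe]
    rw [← List.prod_ofFn]
    congr 1
    exact List.map_ofFn.symm.trans (by rw [List.ofFn_get])
  rw [h1]
  have h2 : S.map f = ∑ j, J j • {f j} :=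
    (map_sum (Multiset.mapAddMonoidHom f) (fun j => J j • ({j} : Multiset (Fin l)))
      Finset.univ).trans (Finset.sum_congr rfl fun j _ => by simp [Multiset.map_nsmul])
  rw [h2, Multiset.prod_sum]
  simp [Multiset.prod_nsmul]

/-- The continuous multilinear map `(v₁, …, v_m) ↦ ∏ v_i(w_i)` attached to a word `w`. -/
noncomputable def wordMultilinear {l m : ℕ} (w : Fin m → Fin l) :
    ContinuousMultilinearMap ℝ (fun _ : Fin m => Fin l → ℝ) ℂ :=
  (ContinuousMultilinearMap.mkPiAlgebra ℝ (Fin m) ℂ).compContinuousLinearMap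
    fun i => Complex.ofRealCLM ∘L ContinuousLinearMap.proj (w i)

theorem wordMultilinear_apply {l m : ℕ} (w : Fin m → Fin l) (v : Fin m → Fin l → ℝ) :
    wordMultilinear w v = ∏ i, ((v i (w i) : ℝ) : ℂ) := by
  simp [wordMultilinear]

theorem norm_wordMultilinear_le {l m : ℕ} (w : Fin m → Fin l) : ‖wordMultilinear w‖ ≤ 1 := by
  refine ContinuousMultilinearMap.opNorm_le_bound zero_le_one fun v => ?_
  rw [wordMultilinear_apply, norm_prod, one_mul]
  refine Finset.prod_le_prod (fun i _ => norm_nonneg _) fun i _ => ?_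
  rw [Complex.norm_real]
  exact norm_le_pi_norm _ _

/-- A multivariate power series converging on all of `ℝˡ` has a real analytic sum. -/
theorem analyticOnNhd_of_hasSum_monomialAt {l : ℕ} {c : (Fin l → ℕ) → ℂ}
    {H : (Fin l → ℝ) → ℂ} (h : ∀ t, HasSum (fun J => c J * monomialAt t J) (H t)) :
    AnalyticOnNhd ℝ H Set.univ := by
  classical
  choose w hw using fun (m : ℕ) (J : {J : Fin l → ℕ // ∑ j, J j = m}) =>
    exists_word_prod_eq J.1 J.2
  have hfin : ∀ m, Finite {J : Fin l → ℕ // ∑ j, J j = m} := fun m =>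
    Finite.of_injective (fun J => (⟨J.1, by simp [Finset.mem_piAntidiag, J.2]⟩ :
      {J // J ∈ Finset.piAntidiag (Finset.univ : Finset (Fin l)) m}))
      fun J J' hJ => Subtype.ext (by simpa using hJ)
  have := fun m => Fintype.ofFinite {J : Fin l → ℕ // ∑ j, J j = m}
  let p : FormalMultilinearSeries ℝ (Fin l → ℝ) ℂ := fun m =>
    ∑ J : {J : Fin l → ℕ // ∑ j, J j = m}, c J.1 • wordMultilinear (w m J)
  have hp : HasFPowerSeriesOnBall H p 0 ⊤ := by
    refine ⟨?_, by simp, fun {y} _ => ?_⟩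
    · rw [top_le_iff]
      refine FormalMultilinearSeries.radius_eq_top_of_summable_norm _ fun r => ?_
      -- Absolute convergence at the diagonal point `(r, …, r)` bounds the norms of the homogeneous
      -- parts, so the radius is infinite.
      have h1 := (h fun _ => (r : ℝ)).summable.norm
      have h2 := HasSum.fiberwise h1.hasSum (fun J => ∑ j, J j)
        (g := fun m => ∑ J : {J : Fin l → ℕ // ∑ j, J j = m}, ‖c J.1‖ * (r : ℝ) ^ m) fun m => by
          have h4 : (fun J : {J : Fin l → ℕ // ∑ j, J j = m} =>
              ‖c J.1 * monomialAt (fun _ => (r : ℝ)) J.1‖) = fun J => ‖c J.1‖ * (r : ℝ) ^ m := by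
            ext1 J
            rw [norm_mul, monomialAt, Finset.prod_pow_eq_pow_sum, norm_pow, Complex.norm_real,
              J.2, Real.norm_of_nonneg r.coe_nonneg]
          rw [h4]
          exact hasSum_fintype _
      refine Summable.of_nonneg_of_le (fun m => by positivity) (fun m => ?_) h2.summable
      rw [← Finset.sum_mul]
      refine mul_le_mul_of_nonneg_right ((norm_sum_le _ _).trans
        (Finset.sum_le_sum fun J _ => ?_)) (by positivity)
      rw [norm_smul]
      exact mul_le_of_le_one_right (norm_nonneg _) (norm_wordMultilinear_le _)
    · rw [zero_add]
      refine HasSum.fiberwise (h y) (fun J => ∑ j, J j) fun m => ?_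
      have h3 : p m (fun _ => y) =
          ∑ J : {J : Fin l → ℕ // ∑ j, J j = m}, c J.1 * monomialAt y J.1 := by
        simp only [p, sum_apply, smul_apply,
          wordMultilinear_apply, smul_eq_mul]
        exact Finset.sum_congr rfl fun J _ => by rw [hw m J fun j => (y j : ℂ), monomialAt]
      rw [h3]
      exact hasSum_fintype _
  have := hp.analyticOnNhd
  rwa [Metric.eball_top_eq_univ] at this

end PowerSeries

/-! ### Haar averages and moments of spherical functions -/

section HaarAverage

theorem apply_eq_sum_single {n : ℕ} {K : Type*} [Group K] (π : K →* (Euc n ≃ₗᵢ[ℝ] Euc n))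
    (k : K) (ξ : Euc n) (i : Fin n) :
    π k ξ i = ∑ j, π k (EuclideanSpace.single j 1) i * ξ j := by
  have h : ξ = ∑ j, ξ j • (EuclideanSpace.single j 1 : Euc n) := by
    ext i
    simp [Pi.single_apply]
  conv_lhs => rw [h]
  simp [map_sum, mul_comm]

variable {K : Type*} [Group K] [TopologicalSpace K] [IsTopologicalGroup K] [CompactSpace K]
  [MeasurableSpace K] [BorelSpace K]

instance isProbabilityMeasure_haarMeasure_top :
    IsProbabilityMeasure (Measure.haarMeasure (⊤ : TopologicalSpace.PositiveCompacts K)) :=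
  ⟨by simpa using Measure.haarMeasure_self (K₀ := (⊤ : TopologicalSpace.PositiveCompacts K))⟩

/-- The Haar measure of a compact group integrates continuous functions right-invariantly. -/
theorem integral_haarMeasure_mul_right {f : K → ℝ} (hf : Continuous f) (g : K) :
    ∫ k, f (k * g) ∂(Measure.haarMeasure (⊤ : TopologicalSpace.PositiveCompacts K)) =
      ∫ k, f k ∂(Measure.haarMeasure (⊤ : TopologicalSpace.PositiveCompacts K)) := by
  set μ := Measure.haarMeasure (⊤ : TopologicalSpace.PositiveCompacts K)
  have hg : Measurable fun k : K => k * g := (continuous_mul_const g).measurable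
  have hmap : ∀ f : K → ℝ, Continuous f → ∫ k, f (k * g) ∂μ = ∫ k, f k ∂(μ.map (· * g)) :=
    fun f hf => (integral_map hg.aemeasurable hf.aestronglyMeasurable).symm
  have hprob : IsProbabilityMeasure (μ.map (· * g)) := Measure.isProbabilityMeasure_map hg.aemeasurable
  -- The right translate of `μ` is again left-invariant, hence a multiple of `μ`; testing on the
  -- constant `1` shows that the factor is `1`.
  have key : ∀ f : K → ℝ, Continuous f → ∫ k, f k ∂(μ.map (· * g)) =
      (Measure.haarScalarFactor (μ.map (· * g)) μ : ℝ) * ∫ k, f k ∂μ := fun f hf => by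
    rw [Measure.integral_isMulLeftInvariant_eq_smul_of_hasCompactSupport (μ.map (· * g)) μ hf
      (HasCompactSupport.of_compactSpace f), integral_smul_nnreal_measure]
    rfl
  have h1 := key (fun _ => 1) continuous_const
  simp only [integral_const, probReal_univ, smul_eq_mul, mul_one] at h1
  rw [hmap f hf, key f hf, ← h1, one_mul]

variable {n : ℕ} (π : K →* (Euc n ≃ₗᵢ[ℝ] Euc n))

open MvPolynomial in
/-- The average of a polynomial over the group is an invariant polynomial. -/
theorem exists_average (hπ : ∀ x : Euc n, Continuous fun k : K => π k x)
    (p : MvPolynomial (Fin n) ℝ) :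
    ∃ q ∈ invariantPolynomials π, ∀ ξ : Euc n, eval (fun i => ξ i) q =
      ∫ k, eval (fun i => π k ξ i) p
        ∂(Measure.haarMeasure (⊤ : TopologicalSpace.PositiveCompacts K)) := by
  set μ := Measure.haarMeasure (⊤ : TopologicalSpace.PositiveCompacts K)
  have hcoord : ∀ (x : Euc n) (i : Fin n), Continuous fun k : K => π k x i := fun x i =>
    (EuclideanSpace.proj (𝕜 := ℝ) i).continuous.comp (hπ x)
  have hcont : ∀ ξ : Euc n, Continuous fun k : K => eval (fun i => π k ξ i) p := fun ξ =>
    (MvPolynomial.continuous_eval p).comp (continuous_pi fun i => hcoord ξ i)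
  let c : Fin n → Fin n → C(K, ℝ) := fun i j =>
    ⟨fun k => π k (EuclideanSpace.single j 1) i, hcoord _ i⟩
  -- Substituting the matrix entries of `π k` gives a polynomial whose coefficients are continuous
  -- functions of `k`; integrating the coefficients gives the average.
  let Q : MvPolynomial (Fin n) C(K, ℝ) := aeval (fun i => ∑ j, C (c i j) * X j) p
  have hQ : ∀ (k : K) (ξ : Euc n), eval (fun i => π k ξ i) p =
      ∑ β ∈ Q.support, coeff β Q k * ∏ i, ξ i ^ β i := by
    intro k ξ
    let ev : C(K, ℝ) →ₐ[ℝ] ℝ := ContinuousMap.evalAlgHom ℝ ℝ k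
    have h1 : eval₂ ev.toRingHom (fun i => ξ i) Q =
        ∑ β ∈ Q.support, coeff β Q k * ∏ i, ξ i ^ β i := eval₂_eq' _ _ _
    rw [← h1]
    have h2 : (eval₂Hom ev.toRingHom (fun i => ξ i)).comp
        (aeval (R := ℝ) (fun i => ∑ j, C (c i j) * X j)).toRingHom = eval (fun i => π k ξ i) := by
      refine MvPolynomial.ringHom_ext (fun r => ?_) fun i => ?_
      · simp [MvPolynomial.algebraMap_eq, IsScalarTower.algebraMap_apply ℝ C(K, ℝ)
          (MvPolynomial (Fin n) C(K, ℝ))]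
      · simp only [RingHom.comp_apply, AlgHom.toRingHom_eq_coe, RingHom.coe_coe, aeval_X, map_sum,
          map_mul, coe_eval₂Hom, eval₂_C, eval₂_X, eval_X]
        exact (apply_eq_sum_single π k ξ i).symm
    exact (congrArg (fun φ => φ p) h2).symm
  have heval : ∀ ξ : Euc n, eval (fun i => ξ i)
      (∑ β ∈ Q.support, monomial β (∫ k, coeff β Q k ∂μ)) = ∫ k, eval (fun i => π k ξ i) p ∂μ := by
    intro ξ
    simp_rw [hQ]
    rw [integral_finsetSum _ fun β _ => ?_]
    · rw [map_sum]
      refine Finset.sum_congr rfl fun β _ => ?_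
      rw [integral_mul_const, eval_monomial, Finsupp.prod_fintype _ _ (by simp)]
    · exact (((coeff β Q).continuous.mul continuous_const).integrable_of_hasCompactSupport
        (HasCompactSupport.of_compactSpace _))
  refine ⟨_, fun g ξ => ?_, heval⟩
  rw [heval, heval]
  have := integral_haarMeasure_mul_right (hcont ξ) g
  simpa [map_mul] using this

/-- The moments `∫_K ⟨x, k ξ⟩ ^ m dk`. -/
noncomputable def sphericalMoment (m : ℕ) (x ξ : Euc n) : ℝ :=
  ∫ k : K, (inner ℝ x (π k ξ) : ℝ) ^ m
    ∂(Measure.haarMeasure (⊤ : TopologicalSpace.PositiveCompacts K))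

theorem sphericalMoment_smul (m : ℕ) (s : ℝ) (x ξ : Euc n) :
    sphericalMoment π m (s • x) ξ = s ^ m * sphericalMoment π m x ξ := by
  simp_rw [sphericalMoment, real_inner_smul_left, mul_pow, integral_const_mul]

/-- Left invariance of Haar measure replaces `k` by `g * k`, and the isometry `π g` cancels from the
inner product. -/
theorem sphericalMoment_apply_left (m : ℕ) (g : K) (x ξ : Euc n) :
    sphericalMoment π m (π g x) ξ = sphericalMoment π m x ξ := by
  rw [sphericalMoment, ← integral_mul_left_eq_self _ g, sphericalMoment]
  refine integral_congr_ae (Filter.Eventually.of_forall fun k => ?_)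
  simp only [map_mul, LinearIsometryEquiv.coe_mul, Function.comp_apply,
    LinearIsometryEquiv.inner_map_map]

/-- The exponential series is integrated termwise, its terms being bounded by `(‖x‖ ‖ξ‖)^m / m!`. -/
theorem hasSum_spherical (hπ : ∀ x : Euc n, Continuous fun k : K => π k x) (x ξ : Euc n) :
    HasSum (fun m => Complex.I ^ m * ((sphericalMoment π m x ξ / m.factorial : ℝ) : ℂ))
      (spherical π ξ x) := by
  set μ := Measure.haarMeasure (⊤ : TopologicalSpace.PositiveCompacts K)
  have hcont : Continuous fun k : K => (inner ℝ x (π k ξ) : ℝ) := continuous_const.inner (hπ ξ)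
  let F : ℕ → K → ℂ := fun m k =>
    (Complex.I * ((inner ℝ x (π k ξ) : ℝ) : ℂ)) ^ m / (m.factorial : ℂ)
  have hFc : ∀ m, Continuous (F m) := fun m => by
    have : Continuous fun k : K => ((inner ℝ x (π k ξ) : ℝ) : ℂ) :=
      Complex.continuous_ofReal.comp hcont
    fun_prop
  have hFi : ∀ m, Integrable (F m) μ := fun m =>
    (hFc m).integrable_of_hasCompactSupport (HasCompactSupport.of_compactSpace _)
  have hb : ∀ m k, ‖F m k‖ ≤ (‖x‖ * ‖ξ‖) ^ m / m.factorial := fun m k => by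
    simp only [F, norm_div, norm_pow, norm_mul, Complex.norm_I, one_mul, Complex.norm_real,
      Complex.norm_natCast]
    gcongr
    simpa using norm_inner_le_norm (𝕜 := ℝ) x (π k ξ)
  have hs : Summable fun m => ∫ k, ‖F m k‖ ∂μ := by
    refine Summable.of_nonneg_of_le (fun m => integral_nonneg fun k => norm_nonneg _) (fun m => ?_)
      (Real.summable_pow_div_factorial (‖x‖ * ‖ξ‖))
    calc ∫ k, ‖F m k‖ ∂μ ≤ ∫ _, (‖x‖ * ‖ξ‖) ^ m / m.factorial ∂μ :=
          integral_mono (hFi m).norm (integrable_const _) (hb m)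
      _ = _ := by simp
  have h := hasSum_integral_of_summable_integral_norm hFi hs
  have h1 : ∀ k, ∑' m, F m k = Complex.exp (Complex.I * ((inner ℝ x (π k ξ) : ℝ) : ℂ)) :=
    fun k => by
      rw [Complex.exp_eq_exp_ℂ]
      exact (NormedSpace.expSeries_div_hasSum_exp _).tsum_eq
  simp_rw [h1] at h
  refine Eq.subst (motive := fun f => HasSum f _) (funext fun m => Eq.symm ?_) h
  simp only [F, mul_pow, mul_div_assoc]
  rw [integral_const_mul, sphericalMoment, ← integral_div, ← integral_complex_ofReal]
  simp only [Complex.ofReal_div, Complex.ofReal_pow, Complex.ofReal_natCast]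
  rfl

theorem iteratedDeriv_zero_of_hasSum {g : ℝ → ℂ} {c : ℕ → ℂ}
    (h : ∀ s : ℝ, HasSum (fun m => s ^ m • c m) (g s)) (m : ℕ) :
    iteratedDeriv m g 0 = (m.factorial : ℂ) * c m := by
  let p : FormalMultilinearSeries ℝ ℝ ℂ := fun m => ContinuousMultilinearMap.mkPiRing ℝ (Fin m) (c m)
  have hp : HasFPowerSeriesAt g p 0 := by
    rw [hasFPowerSeriesAt_iff]
    refine Filter.Eventually.of_forall fun z => ?_
    simpa [p, FormalMultilinearSeries.coeff] using h z
  obtain ⟨r, hr⟩ := hp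
  have := hr.factorial_smul 1 m
  rw [iteratedDeriv_eq_iteratedFDeriv, ← this]
  simp [p]

theorem taylorTerm_spherical (hπ : ∀ x : Euc n, Continuous fun k : K => π k x) (m : ℕ)
    (x ξ : Euc n) : taylorTerm (spherical π ξ) m x =
      Complex.I ^ m * ((sphericalMoment π m x ξ / m.factorial : ℝ) : ℂ) := by
  rw [taylorTerm, iteratedDeriv_zero_of_hasSum (c := fun m =>
    Complex.I ^ m * ((sphericalMoment π m x ξ / m.factorial : ℝ) : ℂ)) fun s => ?_]
  · rw [mul_div_cancel_left₀]
    exact_mod_cast m.factorial_ne_zero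
  · refine Eq.subst (motive := fun f => HasSum f _) (funext fun m => ?_)
      (hasSum_spherical π hπ (s • x) ξ)
    rw [sphericalMoment_smul, Complex.real_smul]
    push_cast
    ring

end HaarAverage

/-! ### Moments expanded in the generators, with factorial bounds -/

section Coefficients

open MvPolynomial

variable {K : Type*} [Group K] [TopologicalSpace K] [IsTopologicalGroup K] [CompactSpace K]
  [MeasurableSpace K] [BorelSpace K] {n : ℕ} (π : K →* (Euc n ≃ₗᵢ[ℝ] Euc n))

theorem prod_X_eq_monomial {m : ℕ} (w : Fin m → Fin n) :
    ∏ i, (X (w i) : MvPolynomial (Fin n) ℝ) = monomial (∑ i, Finsupp.single (w i) 1) 1 := by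
  rw [monomial_sum_one]
  rfl

theorem prod_pow_word {m : ℕ} (w : Fin m → Fin n) (r : Fin n → ℝ) :
    ∏ j, r j ^ (∑ i, Finsupp.single (w i) 1 : Fin n →₀ ℕ) j = ∏ i, r (w i) := by
  have h := congrArg (eval r) (prod_X_eq_monomial w)
  rw [eval_monomial, Finsupp.prod_fintype _ _ (by simp), one_mul, map_prod] at h
  rw [← h]
  simp

theorem inner_pow_eq_sum_words (m : ℕ) (x y : Euc n) :
    (inner ℝ x y : ℝ) ^ m = ∑ w : Fin m → Fin n, (∏ i, y (w i)) * ∏ i, x (w i) := by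
  have h : (inner ℝ x y : ℝ) = ∑ i, y i * x i := by
    simp [PiLp.inner_apply]
  rw [h, Fintype.sum_pow]
  exact Finset.sum_congr rfl fun w _ => Finset.prod_mul_distrib

/-- For homogeneous generators `τ` of the invariants, the moments `∫_K ⟨x, k ξ⟩ ^ m dk` expand in
monomials of `τ(x)` with coefficients that are invariant polynomials in `ξ` and satisfy
factorial bounds. -/
theorem exists_sphericalMoment_expansion {l : ℕ}
    (hπ : ∀ x : Euc n, Continuous fun k : K => π k x)
    (τ : Fin l → MvPolynomial (Fin n) ℝ) (d : Fin l → ℕ) (hd : ∀ j, (τ j).IsHomogeneous (d j))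
    (hτ : Algebra.adjoin ℝ (Set.range τ) = invariantPolynomials π) :
    ∃ (a : (Fin l → ℕ) → MvPolynomial (Fin n) ℝ) (B : ℝ) (s : Fin l → ℝ),
      0 ≤ B ∧ (∀ j, 0 < s j) ∧ (∀ J, a J ∈ invariantPolynomials π) ∧
      (∀ J j, d j = 0 → J j ≠ 0 → a J = 0) ∧
      (∀ (ξ : Euc n) (m : ℕ) (x : Euc n),
        HasSum (fun J : {J : Fin l → ℕ // ∑ j, J j * d j = m} =>
          eval (fun i => ξ i) (a J.1) * ∏ j, polyMap τ x j ^ J.1 j)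
        (sphericalMoment π m x ξ / m.factorial)) ∧
      ∀ (ξ : Euc n) (m : ℕ) (S : Finset (Fin l → ℕ)), (∀ J ∈ S, ∑ j, J j * d j = m) →
        ∑ J ∈ S, |eval (fun i => ξ i) (a J)| * ∏ j, s j ^ J j ≤ (B * ‖ξ‖) ^ m / m.factorial := by
  classical
  set μ := Measure.haarMeasure (⊤ : TopologicalSpace.PositiveCompacts K) with hμ
  -- constant generators are replaced by zero
  let τ' : Fin l → MvPolynomial (Fin n) ℝ := fun j => if d j = 0 then 0 else τ j
  have hd' : ∀ j, (τ' j).IsHomogeneous (d j) := fun j => by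
    by_cases h : d j = 0
    · simp only [τ', if_pos h]; exact isHomogeneous_zero _ _ _
    · simpa only [τ', if_neg h] using hd j
  have hτ' : invariantPolynomials π ≤ Algebra.adjoin ℝ (Set.range τ') := by
    rw [← hτ]
    refine Algebra.adjoin_le ?_
    rintro _ ⟨j, rfl⟩
    by_cases h : d j = 0
    · have h1 := hd j
      rw [h] at h1
      rw [(totalDegree_eq_zero_iff_eq_C).1 (Nat.le_zero.1 h1.totalDegree_le)]
      exact Subalgebra.algebraMap_mem _ _
    · exact Algebra.subset_adjoin ⟨j, if_neg h⟩
  obtain ⟨r, s, N, hr, hs, hN1, hN2⟩ := exists_bounded_lift τ'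
  choose R hR1 hR2 using fun (m : ℕ) (w : Fin m → Fin n) =>
    exists_average π hπ (∏ i, X (w i))
  simp only [map_prod, eval_X, ← hμ] at hR2
  have hcoord : ∀ (x : Euc n) (i : Fin n), Continuous fun k : K => π k x i := fun x i =>
    (EuclideanSpace.proj (𝕜 := ℝ) i).continuous.comp (hπ x)
  have hRc : ∀ (m : ℕ) (w : Fin m → Fin n) (ξ : Euc n),
      Continuous fun k : K => ∏ i, π k ξ (w i) := fun m w ξ =>
    continuous_finsetProd _ fun i _ => hcoord ξ _
  have hRb : ∀ (m : ℕ) (w : Fin m → Fin n) (ξ : Euc n),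
      |eval (fun i => ξ i) (R m w)| ≤ ‖ξ‖ ^ m := by
    intro m w ξ
    rw [hR2]
    have h1 : ∀ k : K, ‖∏ i, π k ξ (w i)‖ ≤ ‖ξ‖ ^ m := fun k => by
      rw [norm_prod]
      calc ∏ i, ‖π k ξ (w i)‖ ≤ ∏ _i : Fin m, ‖ξ‖ := by
            refine Finset.prod_le_prod (fun i _ => norm_nonneg _) fun i _ => ?_
            simpa using PiLp.norm_apply_le (π k ξ) (w i)
        _ = ‖ξ‖ ^ m := by simp
    have h2 := norm_integral_le_of_norm_le_const (μ := μ) (Filter.Eventually.of_forall h1)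
    simpa using h2
  let wt : (Fin l → ℕ) → ℕ := fun J => ∑ j, J j * d j
  let toF : (Fin l → ℕ) → (Fin l →₀ ℕ) := Finsupp.equivFunOnFinite.symm
  -- Exponents using only generators of positive degree. The other monomials vanish at `τ'`, so
  -- their coefficients may be discarded.
  let good : (Fin l → ℕ) → Prop := fun J => ∀ j, d j = 0 → J j = 0
  -- The moment is `∑_w R_w(ξ) x^w` over words `w`. Applying the linear map `N` to each `x^w` yields
  -- coefficients that stay polynomial and invariant in `ξ`.
  let a : (Fin l → ℕ) → MvPolynomial (Fin n) ℝ := fun J => if good J then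
    C ((wt J).factorial : ℝ)⁻¹ * ∑ w : Fin (wt J) → Fin n,
      C (coeff (toF J) (N (∏ i, X (w i)))) * R (wt J) w else 0
  have ha : ∀ J m, wt J = m → good J → ∀ ξ : Euc n, eval (fun i => ξ i) (a J) =
      (m.factorial : ℝ)⁻¹ * ∑ w : Fin m → Fin n,
        coeff (toF J) (N (∏ i, X (w i))) * eval (fun i => ξ i) (R m w) := by
    rintro J m rfl hJ ξ
    simp only [a, if_pos hJ, map_mul, eval_C, map_sum]
  refine ⟨a, ∑ i, r i, s, Finset.sum_nonneg fun i _ => (hr i).le, hs, fun J => ?_,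
    fun J j hj hJ => if_neg fun h => hJ (h j hj), fun ξ m x => ?_, fun ξ m S hS => ?_⟩
  · by_cases hJ : good J
    · simp only [a, if_pos hJ]
      exact Subalgebra.mul_mem _ (Subalgebra.algebraMap_mem _ _)
        (Subalgebra.sum_mem _ fun w _ => Subalgebra.mul_mem _ (Subalgebra.algebraMap_mem _ _)
          (hR1 _ w))
    · simp only [a, if_neg hJ]
      exact Subalgebra.zero_mem _
  -- The single `x^w` need not be invariant, so `N` need not lift them; it does lift their
  -- combination `p`, which is invariant.
  · let p : MvPolynomial (Fin n) ℝ :=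
      ∑ w : Fin m → Fin n, eval (fun i => ξ i) (R m w) • ∏ i, X (w i)
    have hpeval : ∀ x : Euc n, eval (fun i => x i) p = sphericalMoment π m x ξ := by
      intro x
      simp only [p, map_sum, smul_eval, map_prod, eval_X, hR2, sphericalMoment,
        inner_pow_eq_sum_words]
      rw [integral_finsetSum _ fun w _ => ?_]
      · simp_rw [integral_mul_const]
        rfl
      · exact ((hRc m w ξ).mul continuous_const).integrable_of_hasCompactSupport
          (HasCompactSupport.of_compactSpace _)
    have hpinv : p ∈ invariantPolynomials π := fun g y => by
      rw [hpeval (π g y), hpeval, sphericalMoment_apply_left]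
    have hphom : p.IsHomogeneous m := by
      refine IsHomogeneous.sum _ _ _ fun w _ => ?_
      rw [smul_eq_C_mul]
      have h1 : (∏ i, (X (w i) : MvPolynomial (Fin n) ℝ)).IsHomogeneous (∑ _i : Fin m, 1) :=
        IsHomogeneous.prod _ _ _ fun i _ => isHomogeneous_X _ _
      simpa using (isHomogeneous_C (Fin n) (eval (fun i => ξ i) (R m w))).mul h1
    have hcoeff : ∀ J, wt J = m → good J →
        coeff (toF J) (N p) = m.factorial * eval (fun i => ξ i) (a J) := by
      intro J hJ hg
      rw [ha J m hJ hg, mul_inv_cancel_left₀ (by exact_mod_cast m.factorial_ne_zero)]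
      simp only [p, map_sum, map_smul, coeff_sum, coeff_smul, smul_eq_mul]
      exact Finset.sum_congr rfl fun w _ => mul_comm _ _
    have hτhom : ∀ J : Fin l → ℕ, (∏ j, τ' j ^ J j).IsHomogeneous (wt J) := fun J => by
      have := IsHomogeneous.prod Finset.univ (fun j => τ' j ^ J j) (fun j => d j * J j)
        fun j _ => (hd' j).pow (J j)
      simpa only [wt, mul_comm] using this
    have hpexp : p = ∑ J ∈ (N p).support, C (coeff J (N p)) * ∏ j, τ' j ^ J j := by
      conv_lhs => rw [← hN1 p (hτ' hpinv), aeval_def, eval₂_eq']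
      rfl
    -- Projecting to degree `m` leaves `p` unchanged and removes the terms of any other weight.
    have hpexp' : p = ∑ J ∈ (N p).support,
        if wt J = m then C (coeff J (N p)) * ∏ j, τ' j ^ J j else 0 := by
      have h1 : homogeneousComponent m p = p := homogeneousComponent_of_mem hphom |>.trans (if_pos rfl)
      rw [← h1]
      conv_lhs => rw [hpexp, map_sum]
      rw [h1]
      refine Finset.sum_congr rfl fun J _ => ?_
      have h2 := (isHomogeneous_C (Fin n) (coeff J (N p))).mul (hτhom J)
      rw [zero_add] at h2
      rw [homogeneousComponent_of_mem h2]
      simp only [eq_comm]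
    have hval : sphericalMoment π m x ξ / m.factorial =
        ∑ J ∈ (N p).support.image (fun J : Fin l →₀ ℕ => (J : Fin l → ℕ)),
          Set.indicator {J | wt J = m}
            (fun J => eval (fun i => ξ i) (a J) * ∏ j, polyMap τ x j ^ J j) J := by
      rw [Finset.sum_image fun J _ J' _ h => DFunLike.coe_injective h, ← hpeval x, hpexp', map_sum,
        Finset.sum_div]
      rw [← hpexp']
      refine Finset.sum_congr rfl fun J _ => ?_
      by_cases hJ : wt J = m
      · rw [if_pos hJ, Set.indicator_of_mem (by exact hJ)]
        simp only [map_mul, eval_C, map_prod, map_pow]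
        by_cases hg : good J
        · have h3 := hcoeff J hJ hg
          have h4 : toF J = J := Finsupp.equivFunOnFinite.symm_apply_apply J
          rw [h4] at h3
          have h5 : ∏ j, (eval fun i => x i) (τ' j) ^ J j = ∏ j, polyMap τ x j ^ J j := by
            refine Finset.prod_congr rfl fun j _ => ?_
            by_cases hj : d j = 0
            · rw [hg j hj, pow_zero, pow_zero]
            · simp only [τ', if_neg hj, polyMap]
          rw [h3, h5, mul_assoc, mul_div_cancel_left₀ _ (by exact_mod_cast m.factorial_ne_zero)]
        · have h6 : a J = 0 := if_neg hg
          simp only [good] at hg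
          push Not at hg
          obtain ⟨j, hj, hJj⟩ := hg
          rw [h6, map_zero, zero_mul, Finset.prod_eq_zero (Finset.mem_univ j), mul_zero, zero_div]
          simp [τ', hj, hJj]
      · rw [if_neg hJ, Set.indicator_of_notMem (by exact hJ), map_zero, zero_div]
    rw [hval]
    refine (hasSum_subtype_iff_indicator (s := {J | wt J = m})
      (f := fun J => eval (fun i => ξ i) (a J) * ∏ j, polyMap τ x j ^ J j)).2 ?_
    refine hasSum_sum_of_ne_finset_zero fun J hJ => ?_
    by_cases hJm : wt J = m
    · rw [Set.indicator_of_mem (by exact hJm)]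
      by_cases hg : good J
      · have h3 := hcoeff J hJm hg
        have h4 : coeff (toF J) (N p) = 0 := by
          rw [← notMem_support_iff]
          exact fun h => hJ (Finset.mem_image.2 ⟨_, h, rfl⟩)
        rw [h4, eq_comm, mul_eq_zero] at h3
        rw [h3.resolve_left (by exact_mod_cast m.factorial_ne_zero), zero_mul]
      · simp only [a, if_neg hg, map_zero, zero_mul]
    · rw [Set.indicator_of_notMem (by exact hJm)]
  · have hspos : ∀ J : Fin l → ℕ, 0 ≤ ∏ j, s j ^ J j := fun J =>
      Finset.prod_nonneg fun j _ => (pow_pos (hs j) _).le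
    have h1 : ∀ J ∈ S, |eval (fun i => ξ i) (a J)| * ∏ j, s j ^ J j ≤
        (m.factorial : ℝ)⁻¹ * ∑ w : Fin m → Fin n, ‖ξ‖ ^ m *
          (|coeff (toF J) (N (∏ i, X (w i)))| * ∏ j, s j ^ toF J j) := by
      intro J hJ
      by_cases hg : good J
      · rw [ha J m (hS J hJ) hg, abs_mul, abs_of_nonneg (by positivity : (0:ℝ) ≤ (m.factorial : ℝ)⁻¹),
          mul_assoc]
        refine mul_le_mul_of_nonneg_left ?_ (by positivity)
        simp_rw [← mul_assoc]
        rw [← Finset.sum_mul]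
        refine mul_le_mul_of_nonneg_right ((Finset.abs_sum_le_sum_abs _ _).trans
          (Finset.sum_le_sum fun w _ => ?_)) (hspos J)
        rw [abs_mul, mul_comm]
        exact mul_le_mul_of_nonneg_right (hRb m w ξ) (abs_nonneg _)
      · simp only [a, if_neg hg, map_zero, abs_zero, zero_mul]
        have := hspos J
        refine mul_nonneg (by positivity) (Finset.sum_nonneg fun w _ => mul_nonneg (by positivity)
          (mul_nonneg (abs_nonneg _) this))
    refine (Finset.sum_le_sum h1).trans ?_
    -- Each `x^w` contributes at most `∏ i, r (w i)`, and summing over words gives `(∑ i, r i) ^ m`;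
    -- this is the origin of `B`.
    rw [← Finset.mul_sum, Finset.sum_comm, mul_comm _ ‖ξ‖, mul_pow, div_eq_inv_mul,
      Fintype.sum_pow, Finset.mul_sum Finset.univ _ (‖ξ‖ ^ m)]
    refine mul_le_mul_of_nonneg_left (Finset.sum_le_sum fun w _ => ?_) (by positivity)
    rw [← Finset.mul_sum]
    refine mul_le_mul_of_nonneg_left ?_ (by positivity)
    have h2 := sum_abs_coeff_le_polyNorm hs (N (∏ i, X (w i))) (S.map
      (Finsupp.equivFunOnFinite.symm : (Fin l → ℕ) ≃ (Fin l →₀ ℕ)).toEmbedding)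
    rw [Finset.sum_map] at h2
    refine h2.trans ?_
    rw [prod_X_eq_monomial]
    exact (hN2 _).trans_eq (prod_pow_word w r)

end Coefficients

/-! ### Fourier inversion almost everywhere -/

section FourierInversion

open FourierTransform Real

/-- Fourier inversion almost everywhere for an integrable function with integrable Fourier
transform. -/
theorem ae_eq_fourierInv_fourier {V : Type*} [NormedAddCommGroup V] [InnerProductSpace ℝ V]
    [FiniteDimensional ℝ V] [MeasurableSpace V] [BorelSpace V] {f : V → ℂ} (hf : Integrable f)
    (hf' : Integrable (𝓕 f)) : ∀ᵐ x, f x = 𝓕⁻ (𝓕 f) x := by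
  have hc : Continuous (𝓕⁻ (𝓕 f)) := by
    have h1 : Continuous (𝓕 (𝓕 f)) := VectorFourier.fourierIntegral_continuous
      continuous_fourierChar (L := innerₗ V) continuous_inner hf'
    have h2 : 𝓕⁻ (𝓕 f) = fun x => 𝓕 (𝓕 f) (-x) := by
      ext x
      exact fourierInv_eq_fourier_neg _ _
    rw [h2]
    exact h1.comp continuous_neg
  -- Both sides are tested against smooth compactly supported functions; these are Schwartz, so
  -- inversion is known for them and self-adjointness of `𝓕` transfers it to `f`.
  refine ae_eq_of_integral_contDiff_smul_eq hf.locallyIntegrable hc.locallyIntegrable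
    fun g hg hgs => ?_
  have hgs' : HasCompactSupport fun x => (g x : ℂ) := hgs.comp_left Complex.ofReal_zero
  let G : SchwartzMap V ℂ := hgs'.toSchwartzMap (Complex.ofRealCLM.contDiff.comp hg)
  have flip : ∀ (f : V → ℂ), Integrable f → ∀ ψ : SchwartzMap V ℂ,
      ∫ ξ, 𝓕 f ξ * ψ ξ = ∫ x, f x * 𝓕 (ψ : V → ℂ) x := fun f hf ψ => by
    simpa using! VectorFourier.integral_fourierIntegral_smul_eq_flip (L := innerₗ V)
      continuous_fourierChar continuous_inner hf ψ.integrable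
  have h1 : ∫ x, f x * G x = ∫ ξ, 𝓕 f ξ * (𝓕⁻ G) ξ := by
    rw [flip f hf (𝓕⁻ G), ← SchwartzMap.fourier_coe, FourierTransform.fourier_fourierInv_eq]
  have h2 : ∫ ξ, 𝓕 f ξ * (𝓕⁻ G) ξ = ∫ x, 𝓕⁻ (𝓕 f) x * G x := by
    have h3 : ∀ ξ, (𝓕⁻ G) ξ = 𝓕 (G : V → ℂ) (-ξ) := fun ξ => by
      rw [SchwartzMap.fourierInv_coe]
      exact fourierInv_eq_fourier_neg _ _
    simp_rw [h3]
    rw [← integral_neg_eq_self, ← integral_neg_eq_self (fun x => 𝓕⁻ (𝓕 f) x * G x)]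
    simp_rw [neg_neg, fourierInv_eq_fourier_neg, neg_neg]
    have h4 : Integrable fun ξ => 𝓕 f (-ξ) := hf'.comp_neg
    rw [← flip _ h4 G, ← integral_neg_eq_self]
    refine integral_congr_ae (Filter.Eventually.of_forall fun x => ?_)
    simp only
    congr 1
    rw [fourier_eq, fourier_eq, ← integral_neg_eq_self]
    simp
  have h5 : ∀ u : V → ℂ, ∫ x, g x • u x = ∫ x, u x * G x := fun u => by
    refine integral_congr_ae (Filter.Eventually.of_forall fun x => ?_)
    change g x • u x = u x * G x
    rw [Complex.real_smul, mul_comm]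
    rfl
  rw [h5, h5, h1, h2]

variable {n : ℕ}

theorem fourierHat_eq_fourier (f : Euc n → ℂ) (ξ : Euc n) :
    fourierHat f ξ = 𝓕 f ((2 * π)⁻¹ • ξ) := by
  rw [fourier_eq', fourierHat]
  refine integral_congr_ae (Filter.Eventually.of_forall fun x => ?_)
  simp only [smul_eq_mul]
  rw [mul_comm, real_inner_smul_right]
  congr 2
  push_cast
  have : (π : ℂ) ≠ 0 := by exact_mod_cast pi_ne_zero
  field_simp

theorem continuous_fourierHat {f : Euc n → ℂ} (hf : Integrable f) :
    Continuous (fourierHat f) := by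
  have h1 : Continuous (𝓕 f) := VectorFourier.fourierIntegral_continuous
    continuous_fourierChar (L := innerₗ (Euc n)) continuous_inner hf
  have h2 : fourierHat f = fun ξ => 𝓕 f ((2 * π)⁻¹ • ξ) := funext (fourierHat_eq_fourier f)
  rw [h2]
  exact h1.comp (continuous_const_smul _)

theorem continuous_integral_mul_exp {g : Euc n → ℂ} (hg : Integrable g) :
    Continuous fun x : Euc n => ∫ ξ, g ξ * Complex.exp (Complex.I * ((inner ℝ x ξ : ℝ) : ℂ)) := by
  refine continuous_of_dominated (bound := fun ξ => ‖g ξ‖) (fun x => ?_) (fun x => ?_) hg.norm ?_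
  · refine hg.1.mul (Continuous.aestronglyMeasurable ?_)
    fun_prop
  · refine Filter.Eventually.of_forall fun ξ => ?_
    rw [norm_mul, mul_comm Complex.I, Complex.norm_exp_ofReal_mul_I, mul_one]
  · refine Filter.Eventually.of_forall fun ξ => ?_
    fun_prop

/-- Fourier inversion almost everywhere, in the normalization of `fourierHat`. -/
theorem ae_eq_integral_fourierHat {f : Euc n → ℂ} (hf : Integrable f)
    (hf' : Integrable (fourierHat f)) :
    ∀ᵐ x, f x = (((2 * π) ^ n : ℝ) : ℂ)⁻¹ *
      ∫ ξ, fourierHat f ξ * Complex.exp (Complex.I * ((inner ℝ x ξ : ℝ) : ℂ)) := by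
  have h2π : (2 * π) ≠ 0 := by positivity
  have hF : Integrable (𝓕 f) := by
    have h1 := hf'.comp_smul h2π
    refine h1.congr (Filter.Eventually.of_forall fun ξ => ?_)
    simp only [fourierHat_eq_fourier, smul_smul, inv_mul_cancel₀ h2π, one_smul]
  filter_upwards [ae_eq_fourierInv_fourier hf hF] with x hx
  rw [hx, fourierInv_eq']
  -- The substitution `ξ ↦ 2πξ` between the two normalizations produces the factor `(2π)^{-n}`.
  have h1 := Measure.integral_comp_smul (volume : Measure (Euc n))
    (fun ξ => fourierHat f ξ * Complex.exp (Complex.I * ((inner ℝ x ξ : ℝ) : ℂ))) (2 * π)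
  rw [finrank_euclideanSpace_fin, abs_of_pos (by positivity), Complex.real_smul,
    Complex.ofReal_inv] at h1
  rw [← h1]
  refine integral_congr_ae (Filter.Eventually.of_forall fun ξ => ?_)
  simp only [fourierHat_eq_fourier, smul_smul, inv_mul_cancel₀ h2π, one_smul, smul_eq_mul]
  rw [mul_comm, real_inner_smul_right, real_inner_comm]
  congr 2
  push_cast
  ring

end FourierInversion

/-! ### Replacing exponentials by spherical functions -/

section SphericalFourier

variable {K : Type*} [Group K] [TopologicalSpace K] [IsTopologicalGroup K] [CompactSpace K]
  [MeasurableSpace K] [BorelSpace K] {n : ℕ} (π : K →* (Euc n ≃ₗᵢ[ℝ] Euc n))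

theorem fourierHat_apply_of_invariant {n : ℕ} {K : Type*} [Group K]
    (π : K →* (Euc n ≃ₗᵢ[ℝ] Euc n)) {f : Euc n → ℂ}
    (hf : ∀ k : K, ∀ᵐ x, f (π k x) = f x) (k : K) (ξ : Euc n) :
    fourierHat f (π k ξ) = fourierHat f ξ := by
  rw [fourierHat, ← (π k).measurePreserving.integral_comp (π k).toMeasurableEquiv.measurableEmbedding,
    fourierHat]
  refine integral_congr_ae ?_
  filter_upwards [hf k] with x hx
  rw [hx, LinearIsometryEquiv.inner_map_map]

/-- For `K`-invariant integrable `g`, integrating `g` against spherical functions is the same as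
integrating against exponentials. -/
theorem integral_mul_spherical (hπ : ∀ x : Euc n, Continuous fun k : K => π k x)
    {g : Euc n → ℂ} (hg : Integrable g) (hgK : ∀ k ξ, g (π k ξ) = g ξ) (x : Euc n) :
    ∫ ξ, g ξ * spherical π ξ x =
      ∫ ξ, g ξ * Complex.exp (Complex.I * ((inner ℝ x ξ : ℝ) : ℂ)) := by
  set μ := Measure.haarMeasure (⊤ : TopologicalSpace.PositiveCompacts K) with hμ
  -- Only the orbit maps are assumed continuous. By linearity the pairing is a finite sum of
  -- products of a function of `k` and a function of `ξ`, hence jointly measurable.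
  have hmeas : Measurable fun p : Euc n × K => (inner ℝ x (π p.2 p.1) : ℝ) := by
    have h1 : (fun p : Euc n × K => (inner ℝ x (π p.2 p.1) : ℝ)) = fun p =>
        ∑ i, (∑ j, π p.2 (EuclideanSpace.single j 1) i * p.1 j) * x i := by
      ext p
      rw [PiLp.inner_apply]
      exact Finset.sum_congr rfl fun i _ => by rw [← apply_eq_sum_single π]; rfl
    rw [h1]
    refine Finset.measurable_fun_sum _ fun i _ => Measurable.mul_const
      (Finset.measurable_fun_sum _ fun j _ => Measurable.mul ?_ ?_) _
    · exact (((EuclideanSpace.proj (𝕜 := ℝ) i).continuous.comp (hπ _)).measurable).comp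
        measurable_snd
    · exact ((EuclideanSpace.proj (𝕜 := ℝ) j).continuous.measurable).comp measurable_fst
  have hexp : Measurable fun p : Euc n × K =>
      Complex.exp (Complex.I * ((inner ℝ x (π p.2 p.1) : ℝ) : ℂ)) := by
    fun_prop
  have hint : Integrable (fun p : Euc n × K =>
      g p.1 * Complex.exp (Complex.I * ((inner ℝ x (π p.2 p.1) : ℝ) : ℂ))) (volume.prod μ) := by
    refine (hg.comp_fst μ).mono (hg.1.comp_fst.mul hexp.aestronglyMeasurable)
      (Filter.Eventually.of_forall fun p => ?_)
    rw [norm_mul, mul_comm Complex.I, Complex.norm_exp_ofReal_mul_I, mul_one]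
  calc ∫ ξ, g ξ * spherical π ξ x
      = ∫ ξ, ∫ k, g ξ * Complex.exp (Complex.I * ((inner ℝ x (π k ξ) : ℝ) : ℂ)) ∂μ := by
        refine integral_congr_ae (Filter.Eventually.of_forall fun ξ => ?_)
        exact (integral_const_mul _ _).symm
    _ = ∫ k, (∫ ξ, g ξ * Complex.exp (Complex.I * ((inner ℝ x (π k ξ) : ℝ) : ℂ))) ∂μ :=
        integral_integral_swap hint
    _ = ∫ _ : K, (∫ ξ, g ξ * Complex.exp (Complex.I * ((inner ℝ x ξ : ℝ) : ℂ))) ∂μ := by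
        refine integral_congr_ae (Filter.Eventually.of_forall fun k => ?_)
        simp only
        -- After Fubini, the change of variables `ξ ↦ π k ξ` and invariance of `g` make the inner
        -- integral independent of `k`.
        rw [← (π k).measurePreserving.integral_comp (π k).toMeasurableEquiv.measurableEmbedding
          (fun ξ => g ξ * Complex.exp (Complex.I * ((inner ℝ x ξ : ℝ) : ℂ)))]
        simp_rw [hgK]
    _ = _ := by simp

end SphericalFourier

/-! ### Lifted spherical functions and their integrals -/

section Lift

variable {K : Type*} [Group K] [TopologicalSpace K] [IsTopologicalGroup K] [CompactSpace K]
  [MeasurableSpace K] [BorelSpace K] {n : ℕ} (π : K →* (Euc n ≃ₗᵢ[ℝ] Euc n))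

/-- A family with factorial bounds on its weighted homogeneous parts sums, against any monomials,
to something of exponential size. -/
theorem exists_sum_le_exp {l : ℕ} (d : Fin l → ℕ) {s : Fin l → ℝ} (hs : ∀ j, 0 < s j)
    (t : Fin l → ℝ) : ∃ μ : ℝ, 0 ≤ μ ∧ ∀ (b : (Fin l → ℕ) → ℝ) (R : ℝ), 0 ≤ R → (∀ J, 0 ≤ b J) →
      (∀ J j, d j = 0 → J j ≠ 0 → b J = 0) →
      (∀ (m : ℕ) (S : Finset (Fin l → ℕ)), (∀ J ∈ S, ∑ j, J j * d j = m) →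
        ∑ J ∈ S, b J * ∏ j, s j ^ J j ≤ R ^ m / m.factorial) →
      ∀ S : Finset (Fin l → ℕ), ∑ J ∈ S, b J * ∏ j, |t j| ^ J j ≤ Real.exp (μ * R) := by
  classical
  -- This gives `|t j| ≤ μ * s j`; since `μ ≥ 1`, also `|t j| ≤ μ ^ d j * s j` whenever `d j ≠ 0`.
  -- Passing from `s` to `|t|` therefore costs a factor `μ` per unit of weight.
  let μ : ℝ := 1 + ∑ j, |t j| / s j
  have hsum : ∀ j, 0 ≤ |t j| / s j := fun j => div_nonneg (abs_nonneg _) (hs j).le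
  have hμ1 : 1 ≤ μ := le_add_of_nonneg_right (Finset.sum_nonneg fun j _ => hsum j)
  have hμ0 : 0 ≤ μ := zero_le_one.trans hμ1
  have hμt : ∀ j, |t j| ≤ μ * s j := fun j => by
    have h1 := Finset.single_le_sum (fun j _ => hsum j) (Finset.mem_univ j)
    rw [← div_le_iff₀ (hs j)]
    exact h1.trans (le_add_of_nonneg_left zero_le_one)
  refine ⟨μ, hμ0, fun b R hR hb0 hb hbound S => ?_⟩
  have hterm : ∀ J, b J * ∏ j, |t j| ^ J j ≤
      μ ^ (∑ j, J j * d j) * (b J * ∏ j, s j ^ J j) := fun J => by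
    by_cases hJ : ∃ j, d j = 0 ∧ J j ≠ 0
    · obtain ⟨j, hj, hJj⟩ := hJ
      simp [hb J j hj hJj]
    · push Not at hJ
      rw [mul_left_comm, ← Finset.prod_pow_eq_pow_sum, ← Finset.prod_mul_distrib]
      refine mul_le_mul_of_nonneg_left (Finset.prod_le_prod (fun j _ => by positivity)
        fun j _ => ?_) (hb0 J)
      rw [mul_comm (J j), pow_mul, ← mul_pow]
      by_cases hj : d j = 0
      · rw [hJ j hj, pow_zero, pow_zero]
      · refine pow_le_pow_left₀ (abs_nonneg _) ((hμt j).trans ?_) _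
        exact mul_le_mul_of_nonneg_right (le_self_pow₀ hμ1 hj) (hs j).le
  calc ∑ J ∈ S, b J * ∏ j, |t j| ^ J j
      ≤ ∑ J ∈ S, μ ^ (∑ j, J j * d j) * (b J * ∏ j, s j ^ J j) :=
        Finset.sum_le_sum fun J _ => hterm J
    _ = ∑ m ∈ S.image (fun J => ∑ j, J j * d j), ∑ J ∈ S with ∑ j, J j * d j = m,
          μ ^ (∑ j, J j * d j) * (b J * ∏ j, s j ^ J j) :=
        (Finset.sum_fiberwise_of_maps_to (fun J hJ => Finset.mem_image_of_mem _ hJ) _).symm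
    _ ≤ ∑ m ∈ S.image (fun J => ∑ j, J j * d j), (μ * R) ^ m / m.factorial := by
        refine Finset.sum_le_sum fun m _ => ?_
        have h1 : ∀ J ∈ S.filter (fun J => ∑ j, J j * d j = m), ∑ j, J j * d j = m :=
          fun J hJ => (Finset.mem_filter.1 hJ).2
        rw [Finset.sum_congr rfl fun J hJ => by rw [h1 J hJ], ← Finset.mul_sum, mul_pow,
          mul_div_assoc]
        exact mul_le_mul_of_nonneg_left (hbound m _ h1) (pow_nonneg hμ0 _)
    _ ≤ Real.exp (μ * R) := by
        have h2 : HasSum (fun m : ℕ => (μ * R) ^ m / m.factorial) (Real.exp (μ * R)) := by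
          rw [Real.exp_eq_exp_ℝ]
          exact NormedSpace.expSeries_div_hasSum_exp (μ * R)
        exact sum_le_hasSum _ (fun m _ => by positivity) h2

open MvPolynomial in
/-- For homogeneous generators of the invariants, spherical functions lift to globally convergent
power series, whose integrals against compactly supported continuous functions are analytic. -/
theorem exists_sphericalLift {l : ℕ} (hπ : ∀ x : Euc n, Continuous fun k : K => π k x)
    (τ : Fin l → MvPolynomial (Fin n) ℝ) (d : Fin l → ℕ) (hd : ∀ j, (τ j).IsHomogeneous (d j))
    (hτ : Algebra.adjoin ℝ (Set.range τ) = invariantPolynomials π) :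
    ∃ (a : (Fin l → ℕ) → MvPolynomial (Fin n) ℝ) (H : Euc n → (Fin l → ℝ) → ℂ),
      (∀ J, a J ∈ invariantPolynomials π) ∧
      (∀ ξ t, HasSum (fun J => Complex.I ^ (∑ j, J j * d j) *
        ((eval (fun i => ξ i) (a J) : ℝ) : ℂ) * monomialAt t J) (H ξ t)) ∧
      (∀ ξ m x, HasSum (fun J : {J : Fin l → ℕ // ∑ j, J j * d j = m} =>
        Complex.I ^ (∑ j, J.1 j * d j) * ((eval (fun i => ξ i) (a J.1) : ℝ) : ℂ) *
          monomialAt (polyMap τ x) J.1) (taylorTerm (spherical π ξ) m x)) ∧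
      (∀ ξ x, spherical π ξ x = H ξ (polyMap τ x)) ∧
      ∀ g : Euc n → ℂ, Continuous g → HasCompactSupport g →
        (∀ t, Integrable fun ξ => g ξ * H ξ t) ∧
        AnalyticOnNhd ℝ (fun t => ∫ ξ, g ξ * H ξ t) Set.univ := by
  classical
  obtain ⟨a, B, s, hB, hs, ha, ha0, hsum, hbound⟩ :=
    exists_sphericalMoment_expansion π hπ τ d hd hτ
  let c : (Fin l → ℕ) → Euc n → ℂ := fun J ξ =>
    Complex.I ^ (∑ j, J j * d j) * ((eval (fun i => ξ i) (a J) : ℝ) : ℂ)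
  have hcont : ∀ J, Continuous (c J) := fun J => by
    have h1 : Continuous fun ξ : Euc n => eval (fun i => ξ i) (a J) :=
      (MvPolynomial.continuous_eval (a J)).comp (by fun_prop)
    exact continuous_const.mul (Complex.continuous_ofReal.comp h1)
  have hnorm : ∀ J ξ t, ‖c J ξ * monomialAt t J‖ =
      |eval (fun i => ξ i) (a J)| * ∏ j, |t j| ^ J j := fun J ξ t => by
    simp [c, monomialAt, norm_prod]
  choose μ hμ0 hμ using fun t => exists_sum_le_exp d hs t
  -- A bound uniform in the finite set `S` and continuous in `ξ`: it gives absolute convergence here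
  -- and domination on compact supports below.
  have hle : ∀ t ξ (S : Finset (Fin l → ℕ)),
      ∑ J ∈ S, ‖c J ξ * monomialAt t J‖ ≤ Real.exp (μ t * (B * ‖ξ‖)) := fun t ξ S => by
    simp_rw [hnorm]
    exact hμ t (fun J => |eval (fun i => ξ i) (a J)|) (B * ‖ξ‖) (by positivity)
      (fun J => abs_nonneg _) (fun J j hj hJ => by simp [ha0 J j hj hJ]) (hbound ξ) S
  have hsummable : ∀ t ξ, Summable fun J => c J ξ * monomialAt t J := fun t ξ =>
    (summable_of_sum_le (fun J => norm_nonneg _) (hle t ξ)).of_norm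
  let H : Euc n → (Fin l → ℝ) → ℂ := fun ξ t => ∑' J, c J ξ * monomialAt t J
  have hH : ∀ ξ t, HasSum (fun J => c J ξ * monomialAt t J) (H ξ t) := fun ξ t =>
    (hsummable t ξ).hasSum
  have htaylor : ∀ ξ m x, HasSum (fun J : {J : Fin l → ℕ // ∑ j, J j * d j = m} =>
      c J.1 ξ * monomialAt (polyMap τ x) J.1) (taylorTerm (spherical π ξ) m x) := by
    intro ξ m x
    rw [taylorTerm_spherical π hπ]
    have h1 := (Complex.hasSum_ofReal.2 (hsum ξ m x)).mul_left (Complex.I ^ m)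
    refine Eq.subst (motive := fun f => HasSum f _) (funext fun J => ?_) h1
    simp only [c, J.2, monomialAt]
    push_cast
    ring
  refine ⟨a, H, ha, hH, htaylor, fun ξ x => ?_, fun g hg hgs => ?_⟩
  -- Grouped by weight, the lifted series at `polyMap τ x` becomes the moment series of `φ_ξ(x)`.
  · have h1 := HasSum.fiberwise (hH ξ (polyMap τ x)) (fun J => ∑ j, J j * d j)
      fun m => htaylor ξ m x
    simp_rw [taylorTerm_spherical π hπ] at h1
    exact (hasSum_spherical π hπ x ξ).unique h1
  · have hexp : ∀ t, Integrable fun ξ => ‖g ξ‖ * Real.exp (μ t * (B * ‖ξ‖)) := fun t => by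
      refine Continuous.integrable_of_hasCompactSupport (by fun_prop) ?_
      exact hgs.norm.mul_right
    have hF : ∀ t J, Integrable fun ξ => g ξ * (c J ξ * monomialAt t J) := fun t J => by
      refine Continuous.integrable_of_hasCompactSupport
        (hg.mul ((hcont J).mul continuous_const)) hgs.mul_right
    have hint : ∀ t, HasSum (fun J => ∫ ξ, g ξ * (c J ξ * monomialAt t J))
        (∫ ξ, g ξ * H ξ t) := fun t => by
      have h1 : Summable fun J => ∫ ξ, ‖g ξ * (c J ξ * monomialAt t J)‖ := by
        refine summable_of_sum_le (c := ∫ ξ, ‖g ξ‖ * Real.exp (μ t * (B * ‖ξ‖)))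
          (fun J => integral_nonneg fun ξ => norm_nonneg _) fun S => ?_
        rw [← integral_finsetSum _ fun J _ => (hF t J).norm]
        refine integral_mono (integrable_finsetSum _ fun J _ => (hF t J).norm) (hexp t) fun ξ => ?_
        simp_rw [norm_mul (g ξ), ← Finset.mul_sum]
        exact mul_le_mul_of_nonneg_left (hle t ξ S) (norm_nonneg _)
      have h2 := hasSum_integral_of_summable_integral_norm (hF t) h1
      simp_rw [tsum_mul_left] at h2
      exact h2
    refine ⟨fun t => ?_, ?_⟩
    · refine (hexp t).mono' ?_ (Filter.Eventually.of_forall fun ξ => ?_)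
      · refine aestronglyMeasurable_of_tendsto_ae Filter.atTop
          (f := fun (S : Finset (Fin l → ℕ)) ξ => ∑ J ∈ S, g ξ * (c J ξ * monomialAt t J))
          (fun S => (integrable_finsetSum _ fun J _ => hF t J).1)
          (Filter.Eventually.of_forall fun ξ => (hH ξ t).mul_left (g ξ))
      · rw [norm_mul]
        refine mul_le_mul_of_nonneg_left ?_ (norm_nonneg _)
        exact (hH ξ t).norm_le_of_bounded
          ((summable_of_sum_le (fun J => norm_nonneg _) (hle t ξ)).hasSum) (fun J => le_rfl) |>.trans
          (Summable.tsum_le_of_sum_le (summable_of_sum_le (fun J => norm_nonneg _) (hle t ξ))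
            (hle t ξ))
    · refine analyticOnNhd_of_hasSum_monomialAt (c := fun J => ∫ ξ, g ξ * c J ξ) fun t => ?_
      refine Eq.subst (motive := fun f => HasSum f _) (funext fun J => ?_) (hint t)
      simp_rw [← mul_assoc]
      exact integral_mul_const _ _

end Lift

/-! ### Reduction to homogeneous generators -/

section HomogeneousComponents

open MvPolynomial

theorem MvPolynomial.IsHomogeneous.eval_const_mul {n m : ℕ} {p : MvPolynomial (Fin n) ℝ}
    (hp : p.IsHomogeneous m) (s : ℝ) (x : Fin n → ℝ) :
    eval (fun i => s * x i) p = s ^ m * eval x p := by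
  rw [eval_eq', eval_eq', Finset.mul_sum]
  refine Finset.sum_congr rfl fun a ha => ?_
  have h1 : ∑ i, a i = m := by
    have := hp (mem_support_iff.1 ha)
    rw [← this, ← Finsupp.degree_eq_sum, Finsupp.degree_eq_weight_one]
    rfl
  simp_rw [mul_pow, Finset.prod_mul_distrib, Finset.prod_pow_eq_pow_sum, h1]
  ring

/-- The action commutes with scaling, so `s ↦ p (s • x)` is the same polynomial in `s` at `x` and at
`π k x`; its coefficients are the homogeneous components. -/
theorem homogeneousComponent_mem_invariantPolynomials {n : ℕ} {K : Type*} [Group K]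
    {π : K →* (Euc n ≃ₗᵢ[ℝ] Euc n)} {p : MvPolynomial (Fin n) ℝ}
    (hp : p ∈ invariantPolynomials π) (m : ℕ) :
    homogeneousComponent m p ∈ invariantPolynomials π := by
  intro k x
  by_cases hm : p.totalDegree < m
  · rw [homogeneousComponent_eq_zero _ _ hm, map_zero, map_zero]
  let P : Euc n → Polynomial ℝ := fun y => ∑ i ∈ Finset.range (p.totalDegree + 1),
    Polynomial.C (eval (fun j => y j) (homogeneousComponent i p)) * Polynomial.X ^ i
  have hP : ∀ (y : Euc n) (s : ℝ), (P y).eval s = eval (fun j => (s • y) j) p := by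
    intro y s
    conv_rhs => rw [← sum_homogeneousComponent p, map_sum]
    simp only [P, Polynomial.eval_finsetSum, Polynomial.eval_mul, Polynomial.eval_C,
      Polynomial.eval_pow, Polynomial.eval_X]
    refine Finset.sum_congr rfl fun i _ => ?_
    rw [mul_comm]
    exact ((homogeneousComponent_isHomogeneous i p).eval_const_mul s fun j => y j).symm
  have hcoeff : ∀ y : Euc n, (P y).coeff m =
      eval (fun j => y j) (homogeneousComponent m p) := fun y => by
    simp only [P, Polynomial.finsetSum_coeff, Polynomial.coeff_C_mul_X_pow]
    rw [Finset.sum_ite_eq, if_pos (Finset.mem_range.2 (by omega))]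
  rw [← hcoeff, ← hcoeff]
  congr 1
  refine Polynomial.funext fun s => ?_
  rw [hP, hP, ← map_smul]
  exact hp k (s • x)

/-- The homogeneous components of generators of the invariants are homogeneous generators, which
are polynomials in the original ones. -/
theorem exists_homogeneous_generators {n l : ℕ} {K : Type*} [Group K]
    (π : K →* (Euc n ≃ₗᵢ[ℝ] Euc n)) (ρ : Fin l → MvPolynomial (Fin n) ℝ)
    (hρ : Algebra.adjoin ℝ (Set.range ρ) = invariantPolynomials π) :
    ∃ (l' : ℕ) (τ : Fin l' → MvPolynomial (Fin n) ℝ) (d : Fin l' → ℕ)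
      (G : Fin l' → MvPolynomial (Fin l) ℝ), (∀ j, (τ j).IsHomogeneous (d j)) ∧
      Algebra.adjoin ℝ (Set.range τ) = invariantPolynomials π ∧
      ∀ j, aeval ρ (G j) = τ j := by
  let D := ∑ j, (ρ j).totalDegree
  let e : Fin l × Fin (D + 1) ≃ Fin (l * (D + 1)) := finProdFinEquiv
  let τ : Fin (l * (D + 1)) → MvPolynomial (Fin n) ℝ := fun k =>
    homogeneousComponent (e.symm k).2 (ρ (e.symm k).1)
  have hτ : ∀ k, τ k ∈ invariantPolynomials π := fun k =>
    homogeneousComponent_mem_invariantPolynomials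
      (hρ ▸ Algebra.subset_adjoin (Set.mem_range_self _)) _
  have hG : ∀ k, ∃ F : MvPolynomial (Fin l) ℝ, aeval ρ F = τ k := fun k => by
    have h1 := hτ k
    rw [← hρ, Algebra.adjoin_range_eq_range_aeval] at h1
    exact h1
  choose G hG using hG
  refine ⟨_, τ, fun k => (e.symm k).2, G, fun k => homogeneousComponent_isHomogeneous _ _,
    le_antisymm (Algebra.adjoin_le ?_) ?_, hG⟩
  · rintro _ ⟨k, rfl⟩
    exact hτ k
  · rw [← hρ]
    refine Algebra.adjoin_le ?_
    rintro _ ⟨j, rfl⟩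
    rw [SetLike.mem_coe, ← sum_homogeneousComponent (ρ j)]
    refine Subalgebra.sum_mem _ fun i hi => Algebra.subset_adjoin ?_
    have h1 : (ρ j).totalDegree ≤ D :=
      Finset.single_le_sum (f := fun j => (ρ j).totalDegree) (by simp) (Finset.mem_univ j)
    refine ⟨e (j, ⟨i, by have := Finset.mem_range.1 hi; omega⟩), ?_⟩
    simp only [τ, Equiv.symm_apply_apply]

end HomogeneousComponents

/-! ### Assembly of the theorem -/

section Main

theorem eval_aeval_eq_eval_polyMap {n l : ℕ} (ρ : Fin l → MvPolynomial (Fin n) ℝ)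
    (Q : MvPolynomial (Fin l) ℝ) (x : Euc n) :
    MvPolynomial.eval (fun i => x i) (MvPolynomial.aeval ρ Q) =
      MvPolynomial.eval (polyMap ρ x) Q := by
  rw [← MvPolynomial.coe_aeval_eq_eval, RingHom.coe_coe, ← AlgHom.comp_apply,
    MvPolynomial.comp_aeval, ← MvPolynomial.coe_aeval_eq_eval, RingHom.coe_coe]
  rfl

variable {K : Type*} [Group K] [TopologicalSpace K] [IsTopologicalGroup K] [CompactSpace K]
  [MeasurableSpace K] [BorelSpace K] {n l : ℕ} (π : K →* (Euc n ≃ₗᵢ[ℝ] Euc n))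

/-- A lift of the spherical functions lifts invariant functions with compactly supported Fourier
transform. -/
theorem bandLimitedLift_spec (hπ : ∀ x : Euc n, Continuous fun k : K => π k x)
    (ρ : Fin l → MvPolynomial (Fin n) ℝ) {H : Euc n → (Fin l → ℝ) → ℂ}
    (hH : ∀ ξ x, spherical π ξ x = H ξ (polyMap ρ x))
    (hint : ∀ g : Euc n → ℂ, Continuous g → HasCompactSupport g →
      (∀ t, Integrable fun ξ => g ξ * H ξ t) ∧
      AnalyticOnNhd ℝ (fun t => ∫ ξ, g ξ * H ξ t) Set.univ)
    {f : Euc n → ℂ} (hf : Integrable f) (hfK : ∀ k : K, ∀ᵐ x, f (π k x) = f x)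
    (hfs : HasCompactSupport (fourierHat f)) :
    (∀ t, Integrable fun ξ => fourierHat f ξ * H ξ t) ∧
      AnalyticOnNhd ℝ (bandLimitedLift H f) Set.univ ∧
      (∀ᵐ x, f x = bandLimitedLift H f (polyMap ρ x)) ∧
      (Continuous f → ∀ x, f x = bandLimitedLift H f (polyMap ρ x)) := by
  have hc := continuous_fourierHat hf
  have hi : Integrable (fourierHat f) := hc.integrable_of_hasCompactSupport hfs
  obtain ⟨h1, h2⟩ := hint _ hc hfs
  have h3 : ∀ x, bandLimitedLift H f (polyMap ρ x) = (((2 * Real.pi) ^ n : ℝ) : ℂ)⁻¹ *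
      ∫ ξ, fourierHat f ξ * Complex.exp (Complex.I * ((inner ℝ x ξ : ℝ) : ℂ)) := fun x => by
    rw [← integral_mul_spherical π hπ hi (fourierHat_apply_of_invariant π hfK), bandLimitedLift]
    simp_rw [hH]
  have h4 := ae_eq_integral_fourierHat hf hi
  refine ⟨h1, analyticOnNhd_const.mul h2, ?_, fun hfc x => ?_⟩
  · filter_upwards [h4] with x hx
    rw [h3, hx]
  · rw [h3]
    exact congrFun ((Continuous.ae_eq_iff_eq volume hfc
      (continuous_const.mul (continuous_integral_mul_exp hi))).1 h4) x

end Main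

theorem theorem1p3 {n l : ℕ} {K : Type*} [Group K] [TopologicalSpace K]
    [IsTopologicalGroup K] [CompactSpace K] [MeasurableSpace K] [BorelSpace K]
    (π : K →* (Euc n ≃ₗᵢ[ℝ] Euc n))
    (hπ : ∀ x : Euc n, Continuous fun k : K => π k x)
    (ρ : Fin l → MvPolynomial (Fin n) ℝ)
    (hρ : Algebra.adjoin ℝ (Set.range ρ) = invariantPolynomials π) :
    ∃ H : Euc n → (Fin l → ℝ) → ℂ,
      -- each `h_ξ` is real analytic and `φ_ξ = h_ξ ∘ ρ`
      (∀ ξ, AnalyticOnNhd ℝ (H ξ) Set.univ) ∧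
      (∀ ξ x, spherical π ξ x = H ξ (polyMap ρ x)) ∧
      -- for homogeneous generators, `h_ξ(t) = ∑_J q_J(ρ(ξ)) t^J`
      ((∀ j, (ρ j).IsHomogeneous (ρ j).totalDegree) →
        ∃ q : (Fin l → ℕ) → MvPolynomial (Fin l) ℂ,
          IsSphericalExpansion π ρ q ∧
          ∀ ξ t, HasSum (fun J => coeffAt ρ q ξ J * monomialAt t J) (H ξ t)) ∧
      -- the function `h(t) = ∫ f̂(ξ) h_ξ(t) dξ` is well defined, real analytic, and `f = h ∘ ρ`
      ∀ f : Euc n → ℂ, Integrable f →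
        (∀ k : K, ∀ᵐ x, f (π k x) = f x) →
        HasCompactSupport (fourierHat f) →
        (∀ t, Integrable fun ξ => fourierHat f ξ * H ξ t) ∧
        AnalyticOnNhd ℝ (bandLimitedLift H f) Set.univ ∧
        (∀ᵐ x, f x = bandLimitedLift H f (polyMap ρ x)) ∧
        (Continuous f → ∀ x, f x = bandLimitedLift H f (polyMap ρ x)) := by
  -- Homogeneous generators are used as they stand, so that the coefficients of `H` are those
  -- required of `q`.
  by_cases hom : ∀ j, (ρ j).IsHomogeneous (ρ j).totalDegree
  · obtain ⟨a, H, ha, hsum, htaylor, hsph, hint⟩ :=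
      exists_sphericalLift π hπ ρ (fun j => (ρ j).totalDegree) hom hρ
    have hQ : ∀ J, ∃ Q : MvPolynomial (Fin l) ℝ, MvPolynomial.aeval ρ Q = a J := fun J => by
      have h1 := ha J
      rw [← hρ, Algebra.adjoin_range_eq_range_aeval] at h1
      exact h1
    choose Q hQ using hQ
    -- The real polynomial `Q J` expresses the invariant `a J` through `ρ`; the power of `I` comes
    -- from the exponential series.
    let q : (Fin l → ℕ) → MvPolynomial (Fin l) ℂ := fun J =>
      MvPolynomial.C (Complex.I ^ weightedDegree ρ J) * MvPolynomial.map Complex.ofRealHom (Q J)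
    have hq : ∀ ξ J, coeffAt ρ q ξ J = Complex.I ^ weightedDegree ρ J *
        ((MvPolynomial.eval (fun i => ξ i) (a J) : ℝ) : ℂ) := by
      intro ξ J
      rw [coeffAt, map_mul, MvPolynomial.eval_C, ← hQ, eval_aeval_eq_eval_polyMap]
      congr 1
      exact (MvPolynomial.map_eval Complex.ofRealHom (polyMap ρ ξ) (Q J)).symm
    refine ⟨H, fun ξ => analyticOnNhd_of_hasSum_monomialAt (hsum ξ), hsph, fun _ => ⟨q, ?_, ?_⟩,
      fun f hf hfK hfs => bandLimitedLift_spec π hπ ρ hsph hint hf hfK hfs⟩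
    · intro ξ m x
      simp_rw [hq]
      exact htaylor ξ m x
    · intro ξ t
      simp_rw [hq]
      exact hsum ξ t
  · obtain ⟨l', τ, d, G, hd, hτ, hG⟩ := exists_homogeneous_generators π ρ hρ
    obtain ⟨a, H, -, hsum, -, hsph, hint⟩ := exists_sphericalLift π hπ τ d hd hτ
    -- Since `τ = G(ρ)`, composing with the polynomial map `Γ` turns lifts through `τ` into lifts
    -- through `ρ` and preserves analyticity.
    let Γ : (Fin l → ℝ) → Fin l' → ℝ := fun t j => MvPolynomial.eval t (G j)
    have hΓ : AnalyticOnNhd ℝ Γ Set.univ := fun t _ =>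
      AnalyticAt.pi fun j => AnalyticOnNhd.eval_mvPolynomial (G j) t (Set.mem_univ _)
    have hΓρ : ∀ x, polyMap τ x = Γ (polyMap ρ x) := fun x => by
      ext j
      rw [polyMap, ← hG, eval_aeval_eq_eval_polyMap]
    have hsph' : ∀ ξ x, spherical π ξ x = H ξ (Γ (polyMap ρ x)) := fun ξ x => by
      rw [hsph, hΓρ]
    refine ⟨fun ξ t => H ξ (Γ t), fun ξ => ?_, hsph', fun h => absurd h hom, fun f hf hfK hfs =>
      bandLimitedLift_spec π hπ ρ hsph' (fun g hg hgs => ⟨fun t => (hint g hg hgs).1 (Γ t), ?_⟩)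
        hf hfK hfs⟩
    · exact (analyticOnNhd_of_hasSum_monomialAt (hsum ξ)).comp hΓ (Set.mapsTo_univ _ _)
    · exact (hint g hg hgs).2.comp hΓ (Set.mapsTo_univ _ _)
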